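/- **Setting.** Let $(Y,d)$ be a compact metric space with $\operatorname{diam}Y\le 1$ which is an $m$-dimensional manifold whose metric is locally bi-Lipschitz equivalent to the Euclidean one: every point of $Y$ has an open neighbourhood that is bi-Lipschitz homeomorphic to an open subset of $\mathbb R^m$ (for instance, the distance of a Riemannian metric). Let $\mu$ be a Borel probability measure on $Y$ such that, for some $k>0$, $\sup_{y\in Y}\mu(B_d(y,r))=O(r^k)$ as $r\to0$. Let $\Gamma$ be a group generated by a finite set $S$, with word length $|\cdot|$, which acts on $Y$ by measure preserving Lipschitz homeomorphisms. Equip $Y\times[1,\infty)$ with the cone metric $d_{\mathrm{Cone}}((x,s),(y,t))=|s-t|+\min(s,t)\,d(x,y)$, so that $d_{\mathrm{Cone}}((x,t),(y,t))=t\,d(x,y)$. The warped cone $\mathcal O_\Gamma Y$ is the set $Y\times[1,\infty)$ with the largest metric $d_\Gamma$ such that $d_\Gamma\le d_{\mathrm{Cone}}$ and $d_\Gamma((y,t),(\gamma y,t))\le|\gamma|$ for all $(y,t)$ and all $\gamma\in\Gamma$. A $1$-net of a metric space $X$ is a subset $N$ such that every point of $X$ is at distance at most $1$ from some point of $N$.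 For a Banach space $E$, the $E$-distortion $c_E(X)\in[0,\infty]$ is the infimum, over all bi-Lipschitz embeddings $f\colon X\to E$, of $$\sup_{x\ne y}\frac{\|f(x)-f(y)\|}{d(x,y)}\cdot\sup_{x\neq y}\frac{d(x,y)}{\|f(x)-f(y)\|}$$ ($\infty$ if there is no such $f$, and $0$ if $X$ is a single point); $c_2=c_{\ell_2}$. For $1<p<\infty$, the action has a spectral gap on $L_p(Y,\mu;E)$ if there is $\kappa>0$ with $\sup_{s\in S}\|f-\pi_sf\|\ge\kappa\|f\|$ for all $f\in L_p(Y,\mu;E)$ with $\int_Y f\,d\mu=0$, where $\pi_s f(y)=f(s^{-1}y)$. **Statement.** 1. There are constants $a,b>0$ such that for every $t\ge1$ there is a finite $1$-net $Z_t$ of $Y\times\{t\}$ with respect to $d_{\mathrm{Cone}}$, and consequently with respect to $d_\Gamma$, with $a\,t^m\le|Z_t|\le b\,t^m$. 2. Let $E$ be a Banach space and $1<p<\infty$ such that the action has a spectral gap on $L_p(Y,\mu;E)$. Then for every $A$ there is a constant $c>0$ such that for all $t\ge1$ and every finite $1$-net $Z_t$ of $(Y\times\{t\},d_\Gamma)$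 with $|Z_t|\le A\,t^m$, $$c_E(Z_t)\ \ge\ c\,\log|Z_t|,$$ where $Z_t$ carries the metric $d_\Gamma$. 3. There is a universal constant $C>0$ such that, if $E=\ell_2$ in 2, then $c\,\log|Z_t|\le c_2(Z_t)\le C\log|Z_t|$ for all $t$ and $Z_t$ as in 2. Thus $c_2(Z_t)\asymp\log|Z_t|$, and the Euclidean distortion of the nets realizes Bourgain's upper bound. -/

import Mathlib

open MeasureTheory Filter Topology
open scoped NNReal ENNReal

noncomputable section

/-- Word length of `γ` with respect to `S`: the least length of a word in `S ∪ S⁻¹` with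
value `γ`. -/
def wordLength {Γ : Type*} [Group Γ] (S : Finset Γ) (γ : Γ) : ℕ :=
  sInf {n : ℕ | ∃ l : List Γ, (∀ g ∈ l, g ∈ S ∨ g⁻¹ ∈ S) ∧ l.prod = γ ∧ l.length = n}

theorem eq_one_of_wordLength_eq_zero {Γ : Type*} [Group Γ] {S : Finset Γ}
    (hS : Subgroup.closure (S : Set Γ) = ⊤) {γ : Γ} (h : wordLength S γ = 0) : γ = 1 := by
  have hγ : γ ∈ Submonoid.closure ((S : Set Γ) ∪ (S : Set Γ)⁻¹) := by
    rw [← Subgroup.closure_toSubmonoid, hS]; trivial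
  obtain ⟨l, hl, hp⟩ := Submonoid.exists_list_of_mem_closure hγ
  rcases Nat.sInf_eq_zero.mp h with ⟨l', -, hp', h0⟩ | h0
  · rw [List.length_eq_zero_iff] at h0
    subst h0
    simpa using hp'.symm
  · exact absurd (show l.length ∈ (∅ : Set ℕ) from h0 ▸ ⟨l, hl, hp, rfl⟩) (by simp)

/-- The distance of the truncated cone over `Y`, on the set `Y × [1, ∞)`; on the level `t` it
is `t * dist x y`. -/
def coneDist {Y : Type*} [MetricSpace Y] (w w' : Y × Set.Ici (1 : ℝ)) : ℝ :=
  |(w.2 : ℝ) - w'.2| + min (w.2 : ℝ) w'.2 * dist w.1 w'.1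

/-- `ρ` is a metric on `Y × [1, ∞)` which is at most the cone distance and for which `γ` moves
every point by at most the word length of `γ`. The action is `γ (y, t) = (γ y, t)`. -/
structure IsWarpedMetric {Γ Y : Type*} [Group Γ] [MetricSpace Y] [MulAction Γ Y] (S : Finset Γ)
    (ρ : Y × Set.Ici (1 : ℝ) → Y × Set.Ici (1 : ℝ) → ℝ) : Prop where
  self : ∀ w, ρ w w = 0
  eq_of_zero : ∀ w w', ρ w w' = 0 → w = w'
  comm : ∀ w w', ρ w w' = ρ w' w
  triangle : ∀ w w' w'', ρ w w'' ≤ ρ w w' + ρ w' w''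
  le_coneDist : ∀ w w', ρ w w' ≤ coneDist w w'
  le_wordLength : ∀ (γ : Γ) (w), ρ w (γ • w.1, w.2) ≤ wordLength S γ

/-- The largest metric among those of `IsWarpedMetric` (see `isGreatest_warpedDist`). -/
def warpedDist {Γ Y : Type*} [Group Γ] [MetricSpace Y] [MulAction Γ Y] (S : Finset Γ)
    (w w' : Y × Set.Ici (1 : ℝ)) : ℝ :=
  sSup {r : ℝ | ∃ ρ : Y × Set.Ici (1 : ℝ) → Y × Set.Ici (1 : ℝ) → ℝ,
    IsWarpedMetric S ρ ∧ ρ w w' = r}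

theorem exists_isWarpedMetric {Γ Y : Type*} [Group Γ] [MetricSpace Y] [MulAction Γ Y]
    {S : Finset Γ} (hS : Subgroup.closure (S : Set Γ) = ⊤) :
    ∃ ρ : Y × Set.Ici (1 : ℝ) → Y × Set.Ici (1 : ℝ) → ℝ, IsWarpedMetric S ρ := by
  refine ⟨fun w w' => min 1 (|(w.2 : ℝ) - w'.2| + dist w.1 w'.1), ?_, ?_, ?_, ?_, ?_, ?_⟩
  · intro w; simp
  · rintro ⟨x, s⟩ ⟨y, t⟩ h
    have h1 : |(s : ℝ) - t| + dist x y ≤ 0 := by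
      rcases min_choice (1 : ℝ) (|(s : ℝ) - t| + dist x y) with h' | h'
      · rw [h'] at h; norm_num at h
      · rw [h'] at h; exact h.le
    have h2 := abs_nonneg ((s : ℝ) - t)
    have h3 := dist_nonneg (x := x) (y := y)
    have h4 : x = y := dist_le_zero.mp (by linarith)
    have h5 : (s : ℝ) = t := sub_eq_zero.mp (abs_eq_zero.mp (by linarith))
    exact Prod.ext h4 (Subtype.ext h5)
  · intro w w'
    simp only [abs_sub_comm (w.2 : ℝ), dist_comm w.1]
  · intro w w' w''
    have h1 := abs_sub_le (w.2 : ℝ) w'.2 w''.2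
    have h2 := dist_triangle w.1 w'.1 w''.1
    have h3 := abs_nonneg ((w.2 : ℝ) - w'.2)
    have h4 := abs_nonneg ((w'.2 : ℝ) - w''.2)
    have h5 := dist_nonneg (x := w.1) (y := w'.1)
    have h6 := dist_nonneg (x := w'.1) (y := w''.1)
    simp only [min_def]
    split_ifs <;> linarith
  · intro w w'
    refine (min_le_right _ _).trans (add_le_add le_rfl ?_)
    exact le_mul_of_one_le_left dist_nonneg (le_min w.2.2 w'.2.2)
  · intro γ w
    rcases Nat.eq_zero_or_pos (wordLength S γ) with h | h
    · simp [eq_one_of_wordLength_eq_zero hS h]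
    · exact (min_le_left _ _).trans (by exact_mod_cast h)

theorem isGreatest_warpedDist {Γ Y : Type*} [Group Γ] [MetricSpace Y] [MulAction Γ Y]
    {S : Finset Γ} (hS : Subgroup.closure (S : Set Γ) = ⊤) :
    IsGreatest {ρ : Y × Set.Ici (1 : ℝ) → Y × Set.Ici (1 : ℝ) → ℝ | IsWarpedMetric S ρ}
      (warpedDist S) := by
  obtain ⟨ρ₀, h₀⟩ := exists_isWarpedMetric (Y := Y) hS
  have hle : ∀ ρ : Y × Set.Ici (1 : ℝ) → Y × Set.Ici (1 : ℝ) → ℝ, IsWarpedMetric S ρ →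
      ∀ w w', ρ w w' ≤ warpedDist S w w' := fun ρ h w w' =>
    le_csSup ⟨coneDist w w', by rintro _ ⟨ρ, h, rfl⟩; exact h.le_coneDist w w'⟩ ⟨ρ, h, rfl⟩
  have hsup : ∀ w w' : Y × Set.Ici (1 : ℝ), ∀ b : ℝ,
      (∀ ρ : Y × Set.Ici (1 : ℝ) → Y × Set.Ici (1 : ℝ) → ℝ, IsWarpedMetric S ρ → ρ w w' ≤ b) →
      warpedDist S w w' ≤ b := fun w w' b h =>
    csSup_le ⟨_, ρ₀, h₀, rfl⟩ (by rintro _ ⟨ρ, hρ, rfl⟩; exact h ρ hρ)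
  have hnn : ∀ w w' : Y × Set.Ici (1 : ℝ), 0 ≤ ρ₀ w w' := fun w w' => by
    have := h₀.triangle w w' w
    rw [h₀.self, h₀.comm w' w] at this
    linarith
  refine ⟨⟨?_, ?_, ?_, ?_, ?_, ?_⟩, fun ρ h w w' => hle ρ h w w'⟩
  · exact fun w => le_antisymm (hsup _ _ _ fun ρ h => (h.self w).le)
      ((hnn w w).trans (hle ρ₀ h₀ w w))
  · exact fun w w' h => h₀.eq_of_zero w w' (le_antisymm (h ▸ hle ρ₀ h₀ w w') (hnn w w'))
  · exact fun w w' => le_antisymm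
      (hsup _ _ _ fun ρ h => (h.comm w w').le.trans (hle ρ h w' w))
      (hsup _ _ _ fun ρ h => (h.comm w' w).le.trans (hle ρ h w w'))
  · exact fun w w' w'' => hsup _ _ _ fun ρ h =>
      (h.triangle w w' w'').trans (add_le_add (hle ρ h _ _) (hle ρ h _ _))
  · exact fun w w' => hsup _ _ _ fun ρ h => h.le_coneDist w w'
  · exact fun γ w => hsup _ _ _ fun ρ h => h.le_wordLength γ w

/-- The warped cone `𝒪_Γ Y`, where `Γ` is generated by the finite set `S`: the set `Y × [1, ∞)`
with the metric `warpedDist S`. -/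
def WarpedCone (Y : Type*) {Γ : Type*} [Group Γ] (S : Finset Γ)
    (_hS : Subgroup.closure (S : Set Γ) = ⊤) : Type _ :=
  Y × Set.Ici (1 : ℝ)

instance WarpedCone.instMetricSpace {Y Γ : Type*} [Group Γ] [MetricSpace Y] [MulAction Γ Y]
    (S : Finset Γ) (hS : Subgroup.closure (S : Set Γ) = ⊤) : MetricSpace (WarpedCone Y S hS) where
  dist := warpedDist S
  dist_self := (isGreatest_warpedDist hS).1.self
  dist_comm := (isGreatest_warpedDist hS).1.comm
  dist_triangle := (isGreatest_warpedDist hS).1.triangle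
  eq_of_dist_eq_zero := fun h => (isGreatest_warpedDist hS).1.eq_of_zero _ _ h

/-- The level set `Y × {t}` of the warped cone. -/
def WarpedCone.level {Y Γ : Type*} [Group Γ] {S : Finset Γ}
    {hS : Subgroup.closure (S : Set Γ) = ⊤} (t : Set.Ici (1 : ℝ)) : Set (WarpedCone Y S hS) :=
  {w | w.2 = t}

/-- `N` is a `C`-net in the set `A` with respect to the distance function `d`. -/
def IsNet {X : Type*} (d : X → X → ℝ) (C : ℝ) (A N : Set X) : Prop :=
  N ⊆ A ∧ ∀ a ∈ A, ∃ x ∈ N, d x a ≤ C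

/-- `f` is a bi-Lipschitz embedding. -/
def IsBiLipschitz {X E : Type*} [MetricSpace X] [MetricSpace E] (f : X → E) : Prop :=
  ∃ K : ℝ≥0, LipschitzWith K f ∧ AntilipschitzWith K f

/-- The distortion of the map `f`; the suprema are over pairs of distinct points, and a supremum
over no pair is `0`. -/
def mapDistortion {X E : Type*} [MetricSpace X] [MetricSpace E] (f : X → E) : ℝ≥0∞ :=
  (⨆ (x : X) (y : X) (_ : x ≠ y), edist (f x) (f y) / edist x y) *
    (⨆ (x : X) (y : X) (_ : x ≠ y), edist x y / edist (f x) (f y))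

/-- The `E`-distortion of `X`; it is `∞` if `X` has no bi-Lipschitz embedding into `E`. -/
def distortion (E X : Type*) [MetricSpace X] [MetricSpace E] : ℝ≥0∞ :=
  ⨅ (f : X → E) (_ : IsBiLipschitz f), mapDistortion f

/-- The representation `(π_γ f)(y) = f (γ⁻¹ y)` of `Γ` on `L_p(Y, μ; E)` has a spectral gap:
`sup_{s ∈ S} ‖f - π_s f‖ ≥ κ ‖f‖` for some `κ > 0` and all `f` of mean zero. -/
def HasSpectralGap {Γ Y : Type*} [Group Γ] [MulAction Γ Y] [MeasurableSpace Y] (S : Finset Γ)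
    (μ : Measure Y) (p : ℝ≥0∞) (E : Type*) [NormedAddCommGroup E] [NormedSpace ℝ E] : Prop :=
  ∃ κ : ℝ, 0 < κ ∧ ∀ f : Y → E, MemLp f p μ → ∫ y, f y ∂μ = 0 →
    ENNReal.ofReal κ * eLpNorm f p μ ≤ ⨆ s ∈ S, eLpNorm (fun y => f y - f (s⁻¹ • y)) p μ

/-- `Y` is an `n`-dimensional manifold and its metric is locally bi-Lipschitz equivalent to the
Euclidean one, as it is for the distance of any Riemannian metric: every point lies in the domain
of a bi-Lipschitz chart onto an open subset of `ℝⁿ`. -/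
def IsMetricManifold (n : ℕ) (Y : Type*) [MetricSpace Y] : Prop :=
  ∀ y : Y, ∃ e : OpenPartialHomeomorph Y (EuclideanSpace ℝ (Fin n)), y ∈ e.source ∧
    ∃ K : ℝ≥0, LipschitzOnWith K e e.source ∧ LipschitzOnWith K e.symm e.target

end

/-!
Upper bound: let `A` be a random subset of a finite space of `N` points, containing each point
independently with probability `2⁻ʲ`. For each radius `r`, some density `2⁻ʲ` with `2 ^ j ≲ N` makes
`A` meet the smaller of the balls of radius `r` around `x` and `y` and avoid the larger with
probability bounded below; integrating over `r`, the functions `dist (·, A)` at the `O(log N)`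
densities together see `dist x y` up to a constant, which is Bourgain's embedding.

Lower bound: let `f` embed a net of the level `t` into `E` with distortion `D`. Composed with the
map sending a point of `Y` to a nearby point of the net, it moves by a bounded multiple of its
Lipschitz constant under each generator, so by the spectral gap it is close to its mean on half of
`Y`, and half of `Y` lies in a warped ball of radius `O(D)`. But a point of a warped ball of radius
`R` is reached by a group element of word length at most `R` and a short jump in `Y`, so that the
ball has measure at most `C e ^ (β R) t ^ (-k)`. Hence `D` is at least a multiple of `log t`.
-/

section Distortion

variable {X E : Type*} [MetricSpace X] [MetricSpace E]

theorem mapDistortion_le_mul {L M : ℝ≥0} {f : X → E} (hL : LipschitzWith L f)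
    (hM : AntilipschitzWith M f) : mapDistortion f ≤ L * M :=
  mul_le_mul' (iSup₂_le fun x y => iSup_le fun _ => ENNReal.div_le_of_le_mul (hL x y))
    (iSup₂_le fun x y => iSup_le fun _ => ENNReal.div_le_of_le_mul (hM x y))

theorem distortion_le_mul {L M : ℝ≥0} {f : X → E} (hL : LipschitzWith L f)
    (hM : AntilipschitzWith M f) : distortion E X ≤ L * M :=
  (iInf₂_le f ⟨max L M, hL.weaken (le_max_left _ _),
    fun x y => (hM x y).trans (by gcongr; exact le_max_right _ _)⟩).trans
    (mapDistortion_le_mul hL hM)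

theorem distortion_eq_zero_of_subsingleton [Subsingleton X] [Nonempty E] :
    distortion E X = 0 := by
  obtain ⟨e⟩ := ‹Nonempty E›
  have hM : AntilipschitzWith 0 fun _ : X => e := fun x y => by simp [Subsingleton.elim x y]
  simpa using distortion_le_mul (LipschitzWith.const e) hM

theorem IsBiLipschitz.exists_mapDistortion_eq_mul {f : X → E} (hf : IsBiLipschitz f) :
    ∃ L M : ℝ≥0, LipschitzWith L f ∧ AntilipschitzWith M f ∧ mapDistortion f = L * M := by
  obtain ⟨K, hL, hM⟩ := hf
  have hne : ∀ {x y : X}, x ≠ y → edist x y ≠ 0 := fun h => edist_eq_zero.not.mpr h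
  have hne' : ∀ {x y : X}, x ≠ y → edist (f x) (f y) ≠ 0 := fun h =>
    edist_eq_zero.not.mpr (hM.injective.ne h)
  have hexp : (⨆ (x : X) (y : X) (_ : x ≠ y), edist (f x) (f y) / edist x y) ≤ K :=
    iSup₂_le fun x y => iSup_le fun _ => ENNReal.div_le_of_le_mul (hL x y)
  have hcon : (⨆ (x : X) (y : X) (_ : x ≠ y), edist x y / edist (f x) (f y)) ≤ K :=
    iSup₂_le fun x y => iSup_le fun _ => ENNReal.div_le_of_le_mul (hM x y)
  refine ⟨_, _, fun x y => ?_, fun x y => ?_, congrArg₂ (· * ·)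
    (ENNReal.coe_toNNReal (ne_top_of_le_ne_top ENNReal.coe_ne_top hexp)).symm
    (ENNReal.coe_toNNReal (ne_top_of_le_ne_top ENNReal.coe_ne_top hcon)).symm⟩
  all_goals
    rcases eq_or_ne x y with rfl | hxy
    · simp
  · rw [ENNReal.coe_toNNReal (ne_top_of_le_ne_top ENNReal.coe_ne_top hexp),
      ← ENNReal.div_le_iff (hne hxy) (edist_ne_top x y)]
    exact le_iSup₂_of_le x y (le_iSup_of_le hxy le_rfl)
  · rw [ENNReal.coe_toNNReal (ne_top_of_le_ne_top ENNReal.coe_ne_top hcon),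
      ← ENNReal.div_le_iff (hne' hxy) (edist_ne_top _ _)]
    exact le_iSup₂_of_le x y (le_iSup_of_le hxy le_rfl)

theorem one_le_mul_of_lipschitzWith_of_antilipschitzWith [Nontrivial X] {L M : ℝ≥0} {f : X → E}
    (hL : LipschitzWith L f) (hM : AntilipschitzWith M f) : 1 ≤ L * M := by
  obtain ⟨x, y, hxy⟩ := exists_pair_ne X
  have h : dist x y ≤ (L * M : ℝ≥0) * dist x y := by
    calc dist x y ≤ M * dist (f x) (f y) := hM.le_mul_dist x y
      _ ≤ M * (L * dist x y) := by gcongr; exact hL.dist_le_mul x y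
      _ = (L * M : ℝ≥0) * dist x y := by push_cast; ring
  exact_mod_cast le_of_mul_le_mul_right (by simpa using h) (dist_pos.mpr hxy)

end Distortion

section Bourgain

/-- The probability of `A` for the random subset of `X` that contains each point independently
with probability `q`. -/
def bernoulliWeight {X R : Type*} [Fintype X] [CommRing R] (q : R) (A : Finset X) : R :=
  q ^ A.card * (1 - q) ^ (Fintype.card X - A.card)

theorem bernoulliWeight_nonneg {X : Type*} [Fintype X] {q : ℝ} (h0 : 0 ≤ q) (h1 : q ≤ 1)
    (A : Finset X) : 0 ≤ bernoulliWeight q A :=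
  mul_nonneg (pow_nonneg h0 _) (pow_nonneg (sub_nonneg.mpr h1) _)

section Sums

variable {X R : Type*} [Fintype X] [CommRing R] (q : R)

theorem sum_bernoulliWeight : ∑ A : Finset X, bernoulliWeight q A = 1 := by
  simpa [bernoulliWeight] using
    Finset.sum_pow_mul_eq_add_pow q (1 - q) (Finset.univ : Finset X)

variable [DecidableEq X]

theorem sum_bernoulliWeight_disjoint (U : Finset X) :
    ∑ A : Finset X with Disjoint A U, bernoulliWeight q A = (1 - q) ^ U.card := by
  have hset : ({A : Finset X | Disjoint A U} : Finset _) = Uᶜ.powerset := by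
    ext A
    simp [Finset.subset_compl_iff_disjoint_right]
  calc ∑ A : Finset X with Disjoint A U, bernoulliWeight q A
      = ∑ A ∈ Uᶜ.powerset, (1 - q) ^ U.card * (q ^ A.card * (1 - q) ^ (Uᶜ.card - A.card)) := by
        rw [hset]
        refine Finset.sum_congr rfl fun A hA => ?_
        have hA' := Finset.card_le_card (Finset.mem_powerset.mp hA)
        have hU := Finset.card_add_card_compl U
        rw [bernoulliWeight, show Fintype.card X - A.card = U.card + (Uᶜ.card - A.card) by omega,
          pow_add]
        ring
    _ = (1 - q) ^ U.card := by
        rw [← Finset.mul_sum, Finset.sum_pow_mul_eq_add_pow, add_sub_cancel, one_pow, mul_one]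

theorem sum_bernoulliWeight_disjoint_not_disjoint {U V : Finset X} (hUV : Disjoint U V) :
    ∑ A : Finset X with Disjoint A U ∧ ¬ Disjoint A V, bernoulliWeight q A
      = (1 - q) ^ U.card * (1 - (1 - q) ^ V.card) := by
  have hU := sum_bernoulliWeight_disjoint q U
  rw [← Finset.sum_filter_add_sum_filter_not _ (fun A => Disjoint A V)] at hU
  simp only [Finset.filter_filter, ← Finset.disjoint_union_right] at hU
  rw [sum_bernoulliWeight_disjoint, Finset.card_union_of_disjoint hUV, pow_add] at hU
  linear_combination hU

end Sums

theorem quarter_le_one_sub_pow {q : ℝ} (h0 : 0 ≤ q) (h1 : q ≤ 1 / 2) {u : ℕ} (hu : u * q ≤ 1) :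
    1 / 4 ≤ (1 - q) ^ u := by
  -- By concavity `2 ^ (-2 q) ≤ 1 - q`.
  have hbase : (1 / 2 : ℝ) ^ (2 * q) ≤ 1 - q := by
    have h := rpow_one_add_le_one_add_mul_self (s := -1 / 2) (by norm_num)
      (p := 2 * q) (by linarith) (by linarith)
    norm_num at h ⊢
    linarith
  calc (1 / 4 : ℝ) = (1 / 2 : ℝ) ^ (2 : ℝ) := by norm_num
    _ ≤ (1 / 2 : ℝ) ^ (2 * q * u) :=
        Real.rpow_le_rpow_of_exponent_ge (by norm_num) (by norm_num) (by linarith)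
    _ = ((1 / 2 : ℝ) ^ (2 * q)) ^ u := Real.rpow_mul_natCast (by norm_num) _ _
    _ ≤ (1 - q) ^ u := by gcongr

theorem one_sub_pow_le_two_thirds {q : ℝ} (h1 : q ≤ 1) {v : ℕ} (hv : 1 / 2 ≤ v * q) :
    (1 - q) ^ v ≤ 2 / 3 := by
  calc (1 - q) ^ v ≤ Real.exp (-q) ^ v :=
        pow_le_pow_left₀ (by linarith) (Real.one_sub_le_exp_neg q) v
    _ = (Real.exp (v * q))⁻¹ := by rw [← Real.exp_nat_mul, mul_neg, Real.exp_neg]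
    _ ≤ (3 / 2 : ℝ)⁻¹ := by gcongr; linarith [Real.add_one_le_exp (v * q)]
    _ = 2 / 3 := by norm_num

theorem twelfth_le_sum_bernoulliWeight {X : Type*} [Fintype X] [DecidableEq X] {q : ℝ}
    (h0 : 0 ≤ q) (h1 : q ≤ 1 / 2) {U V : Finset X} (hUV : Disjoint U V) (hU : U.card * q ≤ 1)
    (hV : 1 / 2 ≤ V.card * q) :
    1 / 12 ≤ ∑ A : Finset X with Disjoint A U ∧ ¬ Disjoint A V, bernoulliWeight q A := by
  rw [sum_bernoulliWeight_disjoint_not_disjoint q hUV]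
  calc (1 / 12 : ℝ) = 1 / 4 * (1 - 2 / 3) := by norm_num
    _ ≤ _ := mul_le_mul (quarter_le_one_sub_pow h0 h1 hU)
        (sub_le_sub_left (one_sub_pow_le_two_thirds (by linarith) hV) 1) (by norm_num)
        (pow_nonneg (by linarith) _)

theorem inv_two_pow_succ_le_half (j : ℕ) : ((2 : ℝ) ^ (j + 1))⁻¹ ≤ 1 / 2 := by
  rw [one_div]
  exact inv_anti₀ two_pos (le_self_pow₀ one_le_two j.succ_ne_zero)

open scoped Classical in
theorem exists_twelfth_le_sum_mem_uIoc_infDist {X : Type*} [PseudoMetricSpace X] [Fintype X]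
    {x y : X} {r : ℝ} (hr : 0 < r) (hxy : 2 * r ≤ dist x y) :
    ∃ j : Fin (Nat.log 2 (Fintype.card X) + 1), 1 / 12 ≤
      ∑ A ∈ {A : Finset X | r ∈ Set.uIoc (Metric.infDist x A) (Metric.infDist y A)},
        bernoulliWeight ((2 : ℝ) ^ ((j : ℕ) + 1))⁻¹ A := by
  set U : X → Finset X := fun z => (Metric.ball z r).toFinset
  wlog hle : (U x).card ≤ (U y).card generalizing x y
  · simpa only [Set.uIoc_comm] using
      this (x := y) (y := x) (by rwa [dist_comm]) (le_of_not_ge hle)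
  have hUpos : (U x).card ≠ 0 :=
    Finset.card_ne_zero_of_mem (Set.mem_toFinset.mpr (Metric.mem_ball_self hr))
  have hUV : Disjoint (U x) (U y) :=
    Set.disjoint_toFinset.mpr (Metric.ball_disjoint_ball (by linarith))
  set j := Nat.log 2 (U x).card
  have hUj : ((U x).card : ℝ) ≤ 2 ^ (j + 1) := by
    exact_mod_cast (Nat.lt_pow_succ_log_self one_lt_two _).le
  have hVj : (2 : ℝ) ^ j ≤ (U y).card := by
    exact_mod_cast (Nat.pow_log_le_self 2 hUpos).trans hle
  refine ⟨⟨j, Nat.lt_succ_of_le (Nat.log_mono_right (Finset.card_le_univ _))⟩,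
    (twelfth_le_sum_bernoulliWeight (by positivity) (inv_two_pow_succ_le_half j) hUV
      (mul_inv_le_one_of_le₀ hUj (by positivity)) ?_).trans
    (Finset.sum_le_sum_of_subset_of_nonneg (fun A hA => ?_) fun A _ _ =>
      bernoulliWeight_nonneg (by positivity) ((inv_two_pow_succ_le_half j).trans (by norm_num)) A)⟩
  · rw [← div_eq_mul_inv, le_div_iff₀ (by positivity), pow_succ]
    linarith
  · simp only [Finset.mem_filter, Finset.mem_univ, true_and] at hA ⊢
    obtain ⟨a, haA, haV⟩ := Finset.not_disjoint_iff.mp hA.2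
    have hy : Metric.infDist y (A : Set X) < r :=
      (Metric.infDist_lt_iff ⟨a, haA⟩).mpr ⟨a, haA, Metric.mem_ball'.mp (Set.mem_toFinset.mp haV)⟩
    have hx : r ≤ Metric.infDist x (A : Set X) := by
      refine (Metric.le_infDist ⟨a, haA⟩).mpr fun b hb => le_of_not_gt fun hlt => ?_
      exact Finset.disjoint_left.mp hA.1 hb (Set.mem_toFinset.mpr (Metric.mem_ball'.mpr hlt))
    exact ⟨inf_lt_of_right_lt hy, le_sup_of_le_left hx⟩

open scoped Classical in
theorem mul_le_sum_mul_abs_sub {ι : Type*} {s : Finset ι} {w a b : ι → ℝ} {R c : ℝ}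
    (hw : ∀ i ∈ s, 0 ≤ w i) (hR : 0 ≤ R)
    (h : ∀ r ∈ Set.Ioc 0 R, c ≤ ∑ i ∈ s with r ∈ Set.uIoc (a i) (b i), w i) :
    R * c ≤ ∑ i ∈ s, w i * |a i - b i| := by
  have hint : ∀ i ∈ s, IntegrableOn ((Set.uIoc (a i) (b i)).indicator fun _ => w i)
      (Set.Ioc 0 R) := fun i _ =>
    (integrable_const (w i)).indicator measurableSet_uIoc
  calc R * c = ∫ _ in Set.Ioc 0 R, c := by simp [Measure.real, hR]
    _ ≤ ∫ r in Set.Ioc 0 R, ∑ i ∈ s, (Set.uIoc (a i) (b i)).indicator (fun _ => w i) r := by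
        refine setIntegral_mono_on (integrable_const _) (integrable_finsetSum s hint)
          measurableSet_Ioc fun r hr => ?_
        simpa only [Finset.sum_filter, Set.indicator_apply] using h r hr
    _ = ∑ i ∈ s, ∫ r in Set.Ioc 0 R, (Set.uIoc (a i) (b i)).indicator (fun _ => w i) r :=
        integral_finsetSum s hint
    _ ≤ ∑ i ∈ s, w i * |a i - b i| := by
        refine Finset.sum_le_sum fun i hi => ?_
        rw [setIntegral_indicator measurableSet_uIoc, setIntegral_const, smul_eq_mul, mul_comm]
        refine mul_le_mul_of_nonneg_left ?_ (hw i hi)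
        calc volume.real (Set.Ioc 0 R ∩ Set.uIoc (a i) (b i))
            ≤ volume.real (Set.uIoc (a i) (b i)) :=
              measureReal_mono Set.inter_subset_right (by simp [Real.volume_uIoc])
          _ = |a i - b i| := by simp [Measure.real, Real.volume_uIoc, abs_sub_comm]

/-- The map to a Euclidean space whose `i`-th coordinate is the distance to the set `A i`,
scaled so that it contributes with weight `w i` to the square of the norm. -/
noncomputable def frechetMap {X ι : Type*} [PseudoMetricSpace X] (w : ι → ℝ)
    (A : ι → Set X) (x : X) : EuclideanSpace ℝ ι :=
  WithLp.toLp 2 fun i => √(w i) * Metric.infDist x (A i)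

section FrechetMap

variable {X ι : Type*} [PseudoMetricSpace X] [Fintype ι] {w : ι → ℝ}

theorem dist_frechetMap_sq (hw : ∀ i, 0 ≤ w i) (A : ι → Set X) (x y : X) :
    dist (frechetMap w A x) (frechetMap w A y) ^ 2 =
      ∑ i, w i * |Metric.infDist x (A i) - Metric.infDist y (A i)| ^ 2 := by
  rw [EuclideanSpace.dist_eq, Real.sq_sqrt (by positivity)]
  refine Finset.sum_congr rfl fun i _ => ?_
  rw [frechetMap, frechetMap, Real.dist_eq, ← mul_sub, sq_abs, mul_pow, Real.sq_sqrt (hw i), sq_abs]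

theorem dist_frechetMap_le (hw : ∀ i, 0 ≤ w i) (A : ι → Set X) (x y : X) :
    dist (frechetMap w A x) (frechetMap w A y) ≤ √(∑ i, w i) * dist x y := by
  refine le_of_sq_le_sq ?_ (by positivity)
  rw [dist_frechetMap_sq hw, mul_pow, Real.sq_sqrt (Finset.sum_nonneg fun i _ => hw i),
    Finset.sum_mul]
  gcongr with i
  · exact hw i
  · simpa [Real.dist_eq] using (Metric.lipschitz_infDist_pt (A i)).dist_le_mul x y

theorem sum_mul_abs_infDist_sub_le (hw : ∀ i, 0 ≤ w i) (A : ι → Set X) (x y : X) :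
    ∑ i, w i * |Metric.infDist x (A i) - Metric.infDist y (A i)| ≤
      √(∑ i, w i) * dist (frechetMap w A x) (frechetMap w A y) := by
  refine le_of_sq_le_sq ?_ (by positivity)
  rw [mul_pow, dist_frechetMap_sq hw, Real.sq_sqrt (Finset.sum_nonneg fun i _ => hw i)]
  exact Finset.sum_sq_le_sum_mul_sum_of_sq_le_mul _ (fun i _ => hw i)
    (fun i _ => mul_nonneg (hw i) (sq_nonneg _)) fun i _ => le_of_eq (by ring)

end FrechetMap

open scoped Classical in
theorem exists_lipschitzWith_antilipschitzWith_euclideanSpace (X : Type*) [PseudoMetricSpace X]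
    [Fintype X] :
    ∃ F : X → EuclideanSpace ℝ (Fin (Nat.log 2 (Fintype.card X) + 1) × Finset X),
      LipschitzWith (NNReal.sqrt (Nat.log 2 (Fintype.card X) + 1)) F ∧
      AntilipschitzWith (24 * NNReal.sqrt (Nat.log 2 (Fintype.card X) + 1)) F := by
  set m := Nat.log 2 (Fintype.card X) + 1
  let w : Fin m × Finset X → ℝ := fun i => bernoulliWeight ((2 : ℝ) ^ ((i.1 : ℕ) + 1))⁻¹ i.2
  have hw : ∀ i, 0 ≤ w i := fun i =>
    bernoulliWeight_nonneg (by positivity) (by linarith [inv_two_pow_succ_le_half i.1]) _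
  have hsum : √(∑ i, w i) = NNReal.sqrt (Nat.log 2 (Fintype.card X) + 1) := by
    simp [Fintype.sum_prod_type, w, sum_bernoulliWeight, m]
  refine ⟨frechetMap w fun i => i.2, LipschitzWith.of_dist_le_mul fun x y =>
    hsum ▸ dist_frechetMap_le hw _ x y, AntilipschitzWith.of_le_mul_dist fun x y => ?_⟩
  have hlayer : dist x y / 2 * (1 / 12) ≤
      ∑ i, w i * |Metric.infDist x (i.2 : Set X) - Metric.infDist y (i.2 : Set X)| := by
    refine mul_le_sum_mul_abs_sub (fun i _ => hw i) (by positivity) fun r hr => ?_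
    obtain ⟨j, hj⟩ := exists_twelfth_le_sum_mem_uIoc_infDist (x := x) (y := y) hr.1
      (by linarith [hr.2])
    simp only [Finset.sum_filter, Fintype.sum_prod_type] at hj ⊢
    refine hj.trans (Finset.single_le_sum (f := fun j : Fin m => ∑ A : Finset X,
      if r ∈ Set.uIoc (Metric.infDist x A) (Metric.infDist y A) then w (j, A) else 0)
      (fun j _ => Finset.sum_nonneg fun A _ => ?_) (Finset.mem_univ j))
    split_ifs
    exacts [hw (j, A), le_rfl]
  have hF := sum_mul_abs_infDist_sub_le hw (fun i => (i.2 : Set X)) x y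
  rw [hsum] at hF
  push_cast at hF ⊢
  linarith

theorem exists_isometry_euclideanSpace_lp (ι : Type*) [Fintype ι] :
    ∃ F : EuclideanSpace ℝ ι → lp (fun _ : ℕ => ℝ) 2, Isometry F := by
  classical
  have he : Orthonormal ℝ fun n : ℕ => (lp.single 2 n (1 : ℝ) : lp (fun _ : ℕ => ℝ) 2) := by
    rw [orthonormal_iff_ite]
    intro i j
    simp [lp.inner_single_left, lp.single_apply, Pi.single_apply]
  let v := EuclideanSpace.basisFun ι ℝ
  let F := v.toBasis.constr ℝ fun i => (lp.single 2 (Fintype.equivFin ι i : ℕ) (1 : ℝ) :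
    lp (fun _ : ℕ => ℝ) 2)
  have hF : Orthonormal ℝ (F ∘ v.toBasis) := by
    have hcomp : F ∘ v.toBasis = fun i => lp.single 2 (Fintype.equivFin ι i : ℕ) (1 : ℝ) :=
      funext fun i => v.toBasis.constr_basis ℝ _ i
    rw [hcomp]
    exact he.comp _ (Fin.val_injective.comp (Fintype.equivFin ι).injective)
  exact ⟨_, (F.isometryOfOrthonormal (v.coe_toBasis ▸ v.orthonormal) hF).isometry⟩

theorem distortion_lp_le_log (X : Type*) [MetricSpace X] [Finite X] :
    distortion (lp (fun _ : ℕ => ℝ) 2) X ≤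
      ENNReal.ofReal (48 / Real.log 2 * Real.log (Nat.card X)) := by
  have := Fintype.ofFinite X
  rcases subsingleton_or_nontrivial X with _ | _
  · simp [distortion_eq_zero_of_subsingleton]
  obtain ⟨F, hFL, hFM⟩ := exists_lipschitzWith_antilipschitzWith_euclideanSpace X
  obtain ⟨I, hI⟩ := exists_isometry_euclideanSpace_lp
    (Fin (Nat.log 2 (Fintype.card X) + 1) × Finset X)
  refine (distortion_le_mul (hI.lipschitz.comp hFL) (hI.antilipschitz.comp hFM)).trans ?_
  rw [← ENNReal.coe_mul, ENNReal.coe_nnreal_eq]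
  refine ENNReal.ofReal_le_ofReal ?_
  set m := Nat.log 2 (Fintype.card X)
  have hm : 1 ≤ (m : ℝ) := by exact_mod_cast Nat.log_pos one_lt_two Fintype.one_lt_card
  calc ((1 * NNReal.sqrt (m + 1) * (24 * NNReal.sqrt (m + 1) * 1) : ℝ≥0) : ℝ)
      = 24 * (m + 1) := by
        have h := NNReal.mul_self_sqrt (m + 1 : ℝ≥0)
        exact_mod_cast (by linear_combination 24 * h :
          1 * NNReal.sqrt (m + 1) * (24 * NNReal.sqrt (m + 1) * 1) = 24 * (m + 1 : ℝ≥0))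
    _ ≤ 48 * m := by linarith
    _ ≤ 48 * Real.logb 2 (Nat.card X) := by
        rw [Nat.card_eq_fintype_card]
        gcongr
        exact_mod_cast Real.natLog_le_logb (Fintype.card X) 2
    _ = 48 / Real.log 2 * Real.log (Nat.card X) := by rw [← Real.log_div_log]; ring

end Bourgain

section WordLength

variable {Γ : Type*} [Group Γ] {S : Finset Γ}

theorem wordLength_prod_le {l : List Γ} (hl : ∀ g ∈ l, g ∈ S ∨ g⁻¹ ∈ S) :
    wordLength S l.prod ≤ l.length :=
  Nat.sInf_le ⟨l, hl, rfl, rfl⟩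

theorem wordLength_one : wordLength S (1 : Γ) = 0 :=
  Nat.le_zero.mp (wordLength_prod_le (S := S) (l := []) (by simp))

theorem wordLength_inv_le_one {s : Γ} (hs : s ∈ S) : wordLength S s⁻¹ ≤ 1 := by
  simpa using wordLength_prod_le (S := S) (l := [s⁻¹]) (by simpa using Or.inr hs)

theorem exists_list_length_eq_wordLength (hS : Subgroup.closure (S : Set Γ) = ⊤) (γ : Γ) :
    ∃ l : List Γ, (∀ g ∈ l, g ∈ S ∨ g⁻¹ ∈ S) ∧ l.prod = γ ∧ l.length = wordLength S γ := by
  have hγ : γ ∈ Submonoid.closure ((S : Set Γ) ∪ (S : Set Γ)⁻¹) := by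
    rw [← Subgroup.closure_toSubmonoid, hS]
    trivial
  obtain ⟨l, hl, hp⟩ := Submonoid.exists_list_of_mem_closure hγ
  exact Nat.sInf_mem (s := {n : ℕ | ∃ l : List Γ, (∀ g ∈ l, g ∈ S ∨ g⁻¹ ∈ S) ∧
    l.prod = γ ∧ l.length = n}) ⟨l.length, l, hl, hp, rfl⟩

theorem wordLength_induction (hS : Subgroup.closure (S : Set Γ) = ⊤) {P : ℕ → Γ → Prop}
    (one : P 0 1) (mul : ∀ n g γ, (g ∈ S ∨ g⁻¹ ∈ S) → P n γ → P (n + 1) (g * γ)) (γ : Γ) :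
    P (wordLength S γ) γ := by
  obtain ⟨l, hl, rfl, hlen⟩ := exists_list_length_eq_wordLength hS γ
  rw [← hlen]
  clear hlen
  induction l with
  | nil => exact one
  | cons g l ih =>
    exact mul _ g _ (hl g List.mem_cons_self) (ih fun g' hg' => hl g' (List.mem_cons_of_mem g hg'))

theorem wordLength_mul_le (hS : Subgroup.closure (S : Set Γ) = ⊤) (γ γ' : Γ) :
    wordLength S (γ * γ') ≤ wordLength S γ + wordLength S γ' := by
  obtain ⟨l, hl, rfl, h⟩ := exists_list_length_eq_wordLength hS γ
  obtain ⟨l', hl', rfl, h'⟩ := exists_list_length_eq_wordLength hS γ'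
  rw [← h, ← h', ← List.prod_append, ← List.length_append]
  exact wordLength_prod_le fun g hg => (List.mem_append.mp hg).elim (hl g) (hl' g)

theorem wordLength_inv (hS : Subgroup.closure (S : Set Γ) = ⊤) (γ : Γ) :
    wordLength S γ⁻¹ = wordLength S γ := by
  have hle : ∀ γ : Γ, wordLength S γ⁻¹ ≤ wordLength S γ := fun γ => by
    obtain ⟨l, hl, rfl, h⟩ := exists_list_length_eq_wordLength hS γ
    rw [← h, List.prod_inv_reverse]
    refine (wordLength_prod_le fun g hg => ?_).trans (by simp)
    obtain ⟨g', hg', rfl⟩ := List.mem_map.mp (List.mem_reverse.mp hg)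
    simpa [or_comm] using hl g' hg'
  exact le_antisymm (hle γ) (by simpa using hle γ⁻¹)

open scoped Pointwise in
theorem mem_pow_of_wordLength_le [DecidableEq Γ] (hS : Subgroup.closure (S : Set Γ) = ⊤) {n : ℕ}
    {γ : Γ} (h : wordLength S γ ≤ n) : γ ∈ (insert 1 (S ∪ S⁻¹)) ^ n := by
  refine Finset.pow_subset_pow_right (Finset.mem_insert_self _ _) h ?_
  refine wordLength_induction hS (P := fun n γ => γ ∈ (insert 1 (S ∪ S⁻¹)) ^ n) (by simp)
    (fun n g γ hg hγ => ?_) γ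
  rw [pow_succ']
  refine Finset.mul_mem_mul (Finset.mem_insert_of_mem ?_) hγ
  simpa using hg

theorem exists_dist_smul_le_exp_wordLength {Y : Type*} [PseudoMetricSpace Y] [MulAction Γ Y]
    (hS : Subgroup.closure (S : Set Γ) = ⊤)
    (hL : ∀ γ : Γ, ∃ L : ℝ≥0, LipschitzWith L (fun y : Y => γ • y)) :
    ∃ a : ℝ, 1 ≤ a ∧ ∀ (γ : Γ) (x y : Y),
      dist (γ • x) (γ • y) ≤ Real.exp (a * wordLength S γ) * dist x y := by
  classical
  choose L hL using hL
  set b : ℝ := ∑ s ∈ S, ((L s : ℝ) + L s⁻¹)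
  have hb : 0 ≤ b := Finset.sum_nonneg fun s _ => by positivity
  have hgen : ∀ g : Γ, (g ∈ S ∨ g⁻¹ ∈ S) → (L g : ℝ) ≤ Real.exp (b + 1) := fun g hg => by
    have hle : ∀ s ∈ S, (L s : ℝ) + L s⁻¹ ≤ b := fun s hs =>
      Finset.single_le_sum (f := fun s => (L s : ℝ) + L s⁻¹) (fun s _ => by positivity) hs
    have hexp := Real.add_one_le_exp (b + 1)
    rcases hg with hg | hg
    · linarith [hle g hg, (L g⁻¹).coe_nonneg]
    · have := hle _ hg
      rw [inv_inv] at this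
      linarith [(L g⁻¹).coe_nonneg]
  refine ⟨b + 1, by linarith, fun γ x y => ?_⟩
  refine wordLength_induction hS
    (P := fun n γ => dist (γ • x) (γ • y) ≤ Real.exp ((b + 1) * n) * dist x y) (by simp)
    (fun n g γ hg ih => ?_) γ
  calc dist ((g * γ) • x) ((g * γ) • y)
      = dist (g • γ • x) (g • γ • y) := by simp only [mul_smul]
    _ ≤ L g * dist (γ • x) (γ • y) := (hL g).dist_le_mul _ _
    _ ≤ Real.exp (b + 1) * (Real.exp ((b + 1) * n) * dist x y) := by
      gcongr
      exact hgen g hg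
    _ = Real.exp ((b + 1) * (n + 1 : ℕ)) * dist x y := by
      rw [← mul_assoc, ← Real.exp_add]
      push_cast
      ring_nf

end WordLength

section WarpedDist

variable {Γ Y : Type*} [Group Γ] [MetricSpace Y] [MulAction Γ Y] {S : Finset Γ}

theorem coneDist_comm (w w' : Y × Set.Ici (1 : ℝ)) : coneDist w w' = coneDist w' w := by
  simp only [coneDist, abs_sub_comm (w.2 : ℝ), dist_comm w.1, min_comm (w.2 : ℝ)]

theorem level_pos (t : Set.Ici (1 : ℝ)) : (0 : ℝ) < t := one_pos.trans_le t.2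

theorem le_warpedDist (hS : Subgroup.closure (S : Set Γ) = ⊤)
    {ρ : Y × Set.Ici (1 : ℝ) → Y × Set.Ici (1 : ℝ) → ℝ}
    (self : ∀ w, ρ w w = 0) (comm : ∀ w w', ρ w w' = ρ w' w)
    (triangle : ∀ w w' w'', ρ w w'' ≤ ρ w w' + ρ w' w'')
    (le_coneDist : ∀ w w', ρ w w' ≤ coneDist w w')
    (le_wordLength : ∀ (γ : Γ) (w), ρ w (γ • w.1, w.2) ≤ wordLength S γ)
    (w w' : Y × Set.Ici (1 : ℝ)) : ρ w w' ≤ warpedDist S w w' := by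
  obtain ⟨hd, hmax⟩ := isGreatest_warpedDist (Y := Y) hS
  have hnonneg : ∀ w w' : Y × Set.Ici (1 : ℝ), 0 ≤ warpedDist S w w' := fun w w' =>
    dist_nonneg (α := WarpedCone Y S hS) (x := w) (y := w')
  have hρd : IsWarpedMetric S fun w w' => max (ρ w w') (warpedDist S w w') :=
    { self := fun w => by simp [self, hd.self]
      eq_of_zero := fun w w' h => hd.eq_of_zero w w'
        (le_antisymm ((le_max_right _ _).trans h.le) (hnonneg w w'))
      comm := fun w w' => by rw [comm, hd.comm]
      triangle := fun w w' w'' => max_le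
        ((triangle w w' w'').trans (add_le_add (le_max_left _ _) (le_max_left _ _)))
        ((hd.triangle w w' w'').trans (add_le_add (le_max_right _ _) (le_max_right _ _)))
      le_coneDist := fun w w' => max_le (le_coneDist w w') (hd.le_coneDist w w')
      le_wordLength := fun γ w => max_le (le_wordLength γ w) (hd.le_wordLength γ w) }
  exact (le_max_left _ _).trans (hmax hρd w w')

theorem exists_lt_of_warpedDist_lt (hS : Subgroup.closure (S : Set Γ) = ⊤)
    {P : ℝ → Y × Set.Ici (1 : ℝ) → Y × Set.Ici (1 : ℝ) → Prop}
    (trans : ∀ c c' w w' w'', P c w w' → P c' w' w'' → P (c + c') w w'')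
    (cone : ∀ w w', P (coneDist w w') w w')
    (smul : ∀ (γ : Γ) (w), P (wordLength S γ) w (γ • w.1, w.2))
    {R : ℝ} {w w' : Y × Set.Ici (1 : ℝ)} (h : warpedDist S w w' < R) :
    ∃ c < R, P c w w' := by
  -- The infimum of these costs is a pseudometric subject to the constraints of `warpedDist`.
  let cost : Y × Set.Ici (1 : ℝ) → Y × Set.Ici (1 : ℝ) → Set ℝ := fun w w' =>
    {c | 0 ≤ c ∧ P c w w' ∧ P c w' w}
  have hbdd : ∀ w w', BddBelow (cost w w') := fun w w' => ⟨0, fun c hc => hc.1⟩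
  have hcone : ∀ w w', coneDist w w' ∈ cost w w' := fun w w' =>
    ⟨by have := level_pos w.2; have := level_pos w'.2; unfold coneDist; positivity,
      cone w w', coneDist_comm w w' ▸ cone w' w⟩
  have hle : sInf (cost w w') ≤ warpedDist S w w' := by
    refine le_warpedDist (ρ := fun w w' => sInf (cost w w')) hS (fun w => ?_) (fun w w' => ?_)
      (fun w w' w'' => ?_) (fun w w' => csInf_le (hbdd w w') (hcone w w')) (fun γ w => ?_) w w'
    · refine le_antisymm ?_ (Real.sInf_nonneg fun c hc => hc.1)
      exact (csInf_le (hbdd w w) (hcone w w)).trans (by simp [coneDist])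
    · exact congrArg sInf (Set.ext fun c => and_congr_right' and_comm)
    · rw [← csInf_add ⟨_, hcone w w'⟩ (hbdd w w') ⟨_, hcone w' w''⟩ (hbdd w' w'')]
      refine csInf_le_csInf (hbdd w w'')
        (Set.add_nonempty.mpr ⟨⟨_, hcone w w'⟩, _, hcone w' w''⟩) ?_
      rintro _ ⟨c, ⟨hc, hcw, hcw'⟩, c', ⟨hc', hcw₁, hcw₁'⟩, rfl⟩
      exact ⟨add_nonneg hc hc', trans _ _ _ _ _ hcw hcw₁,
        by simpa only [add_comm c] using trans _ _ _ _ _ hcw₁' hcw'⟩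
    · refine csInf_le (hbdd _ _) ⟨Nat.cast_nonneg _, smul γ w, ?_⟩
      simpa [wordLength_inv hS] using smul γ⁻¹ (γ • w.1, w.2)
  obtain ⟨c, hc, hlt⟩ := exists_lt_of_csInf_lt ⟨_, hcone w w'⟩ (hle.trans_lt h)
  exact ⟨c, hlt, hc.2.1⟩

/-- Some `γ` of length at most `c` moves `w` close to `w'`, while the level drops by a factor of at
most `exp c`. This is what remains of a chain of cone steps and group steps of total length `c`
once the group steps are moved past the cone steps; `exp a` bounds the Lipschitz constants of the
generators. -/
def WarpedClose (S : Finset Γ) (a c : ℝ) (w w' : Y × Set.Ici (1 : ℝ)) : Prop :=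
  ∃ γ : Γ, (wordLength S γ : ℝ) ≤ c ∧ (w.2 : ℝ) ≤ Real.exp c * w'.2 ∧
    w.2 * dist (γ • w.1) w'.1 ≤ c * Real.exp (a * c)

theorem WarpedClose.trans (hS : Subgroup.closure (S : Set Γ) = ⊤) {a : ℝ} (ha : 1 ≤ a)
    (hLip : ∀ (γ : Γ) (x y : Y),
      dist (γ • x) (γ • y) ≤ Real.exp (a * wordLength S γ) * dist x y)
    {c c' : ℝ} {w w' w'' : Y × Set.Ici (1 : ℝ)} (h : WarpedClose S a c w w')
    (h' : WarpedClose S a c' w' w'') : WarpedClose S a (c + c') w w'' := by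
  obtain ⟨γ, hγ, hw, hd⟩ := h
  obtain ⟨γ', hγ', hw', hd'⟩ := h'
  have hc : 0 ≤ c := (Nat.cast_nonneg _).trans hγ
  have : 0 ≤ c' := (Nat.cast_nonneg _).trans hγ'
  have hw0 := level_pos w.2
  have hw0' := level_pos w'.2
  have hmul : (wordLength S (γ' * γ) : ℝ) ≤ wordLength S γ' + wordLength S γ := by
    exact_mod_cast wordLength_mul_le hS γ' γ
  refine ⟨γ' * γ, by linarith, ?_, ?_⟩
  · calc (w.2 : ℝ) ≤ Real.exp c * (Real.exp c' * w''.2) := hw.trans (by gcongr)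
      _ = Real.exp (c + c') * w''.2 := by rw [Real.exp_add, mul_assoc]
  · calc w.2 * dist ((γ' * γ) • w.1) w''.1
        ≤ w.2 * (dist (γ' • γ • w.1) (γ' • w'.1) + dist (γ' • w'.1) w''.1) := by
          rw [mul_smul]
          gcongr
          exact dist_triangle _ _ _
      _ ≤ w.2 * (Real.exp (a * c') * dist (γ • w.1) w'.1) +
            Real.exp c * w'.2 * dist (γ' • w'.1) w''.1 := by
          rw [mul_add]
          gcongr
          exact (hLip _ _ _).trans (by gcongr)
      _ = Real.exp (a * c') * (w.2 * dist (γ • w.1) w'.1) +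
            Real.exp (1 * c) * (w'.2 * dist (γ' • w'.1) w''.1) := by ring_nf
      _ ≤ Real.exp (a * c') * (c * Real.exp (a * c)) +
            Real.exp (a * c) * (c' * Real.exp (a * c')) := by gcongr
      _ = (c + c') * Real.exp (a * (c + c')) := by
          rw [mul_add a, Real.exp_add]
          ring

theorem warpedClose_coneDist {a : ℝ} (ha : 1 ≤ a) (w w' : Y × Set.Ici (1 : ℝ)) :
    WarpedClose S a (coneDist w w') w w' := by
  have hw := level_pos w.2
  have hw' := level_pos w'.2
  set c := coneDist w w' with hcdef
  have hmin : min (w.2 : ℝ) w'.2 * dist w.1 w'.1 ≤ c := by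
    rw [hcdef, coneDist]
    linarith [abs_nonneg ((w.2 : ℝ) - w'.2)]
  have habs : |(w.2 : ℝ) - w'.2| ≤ c := le_add_of_nonneg_right (by positivity)
  have hc : 0 ≤ c := (abs_nonneg _).trans habs
  have hlevel : (w.2 : ℝ) ≤ Real.exp c * w'.2 := by
    calc (w.2 : ℝ) ≤ c * 1 + w'.2 := by linarith [le_abs_self ((w.2 : ℝ) - w'.2)]
      _ ≤ c * w'.2 + w'.2 := by gcongr; exact w'.2.2
      _ = (c + 1) * w'.2 := by ring
      _ ≤ Real.exp c * w'.2 := by gcongr; exact Real.add_one_le_exp c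
  have hlevel_min : (w.2 : ℝ) ≤ Real.exp c * min (w.2 : ℝ) w'.2 := by
    rw [mul_min_of_nonneg _ _ (Real.exp_nonneg c)]
    exact le_min (le_mul_of_one_le_left hw.le (Real.one_le_exp hc)) hlevel
  refine ⟨1, by simpa [wordLength_one] using hc, hlevel, ?_⟩
  calc w.2 * dist ((1 : Γ) • w.1) w'.1
      ≤ Real.exp c * min (w.2 : ℝ) w'.2 * dist w.1 w'.1 := by
        rw [one_smul]
        gcongr
    _ = Real.exp (1 * c) * (min (w.2 : ℝ) w'.2 * dist w.1 w'.1) := by ring_nf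
    _ ≤ Real.exp (a * c) * c := by gcongr
    _ = c * Real.exp (a * c) := mul_comm _ _

theorem warpedClose_smul (a : ℝ) (γ : Γ) (w : Y × Set.Ici (1 : ℝ)) :
    WarpedClose S a (wordLength S γ) w (γ • w.1, w.2) := by
  have hw := level_pos w.2
  refine ⟨γ, le_rfl, le_mul_of_one_le_left hw.le (Real.one_le_exp (Nat.cast_nonneg _)), ?_⟩
  rw [dist_self, mul_zero]
  positivity

open scoped Pointwise in
theorem setOf_warpedDist_lt_subset [DecidableEq Γ] (hS : Subgroup.closure (S : Set Γ) = ⊤) {a : ℝ}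
    (ha : 1 ≤ a)
    (hLip : ∀ (γ : Γ) (x y : Y),
      dist (γ • x) (γ • y) ≤ Real.exp (a * wordLength S γ) * dist x y)
    (x : Y) (t : Set.Ici (1 : ℝ)) (R : ℝ) :
    {y | warpedDist S (x, t) (y, t) < R} ⊆
      ⋃ γ ∈ (insert 1 (S ∪ S⁻¹)) ^ ⌊R⌋₊, Metric.ball (γ • x) (R * Real.exp (a * R) / t) := by
  intro y hy
  obtain ⟨c, hcR, γ, hγ, -, hd⟩ := exists_lt_of_warpedDist_lt hS
    (fun _ _ _ _ _ => WarpedClose.trans hS ha hLip) (warpedClose_coneDist ha)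
    (warpedClose_smul a) hy
  have hc : 0 ≤ c := (Nat.cast_nonneg _).trans hγ
  refine Set.mem_biUnion (mem_pow_of_wordLength_le hS (Nat.le_floor (hγ.trans hcR.le))) ?_
  rw [Metric.mem_ball', lt_div_iff₀' (level_pos t)]
  calc t * dist (γ • x) y ≤ c * Real.exp (a * c) := hd
    _ < R * Real.exp (a * R) := by gcongr

end WarpedDist

section WarpedBall

theorem exists_measureReal_ball_le {Y : Type*} [PseudoMetricSpace Y] [MeasurableSpace Y]
    (μ : Measure Y) [IsFiniteMeasure μ] {k : ℝ} (hk : 0 ≤ k)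
    (hμ : (fun r : ℝ => ⨆ y : Y, μ.real (Metric.ball y r)) =O[𝓝[>] 0] (fun r : ℝ => r ^ k)) :
    ∃ C : ℝ, 0 ≤ C ∧ ∀ (y : Y) (r : ℝ), 0 < r → μ.real (Metric.ball y r) ≤ C * r ^ k := by
  obtain ⟨c, hc⟩ := hμ.bound
  obtain ⟨r₀, hr₀, hsmall⟩ := mem_nhdsGT_iff_exists_Ioo_subset.mp hc
  have hr₀ : 0 < r₀ := hr₀
  have hle_univ : ∀ s : Set Y, μ.real s ≤ μ.real Set.univ := fun s =>
    measureReal_mono (Set.subset_univ s)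
  refine ⟨max c (μ.real Set.univ / r₀ ^ k), le_max_of_le_right (by positivity),
    fun y r hr => ?_⟩
  rcases lt_or_ge r r₀ with hlt | hge
  · calc μ.real (Metric.ball y r) ≤ ⨆ y : Y, μ.real (Metric.ball y r) :=
          le_ciSup (f := fun y : Y => μ.real (Metric.ball y r))
            ⟨μ.real Set.univ, by rintro _ ⟨y, rfl⟩; exact hle_univ _⟩ y
      _ ≤ c * ‖r ^ k‖ := (le_abs_self _).trans (hsmall ⟨hr, hlt⟩)
      _ ≤ max c (μ.real Set.univ / r₀ ^ k) * r ^ k := by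
          rw [Real.norm_of_nonneg (by positivity)]
          gcongr
          exact le_max_left _ _
  · calc μ.real (Metric.ball y r) ≤ μ.real Set.univ / r₀ ^ k * r₀ ^ k := by
          rw [div_mul_cancel₀ _ (by positivity)]
          exact hle_univ _
      _ ≤ max c (μ.real Set.univ / r₀ ^ k) * r ^ k := by
          gcongr
          exact le_max_right _ _

variable {Γ Y : Type*} [Group Γ] [MetricSpace Y] [MulAction Γ Y] {S : Finset Γ}
  [MeasurableSpace Y] (μ : Measure Y) [IsFiniteMeasure μ]

open scoped Pointwise in
theorem exists_measureReal_warpedBall_le (hS : Subgroup.closure (S : Set Γ) = ⊤) {k : ℝ}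
    (hk : 0 ≤ k) (hLip : ∀ γ : Γ, ∃ L : ℝ≥0, LipschitzWith L (fun y : Y => γ • y))
    (hμ : (fun r : ℝ => ⨆ y : Y, μ.real (Metric.ball y r)) =O[𝓝[>] 0] (fun r : ℝ => r ^ k)) :
    ∃ C β : ℝ, 0 ≤ β ∧ ∀ (x : Y) (t : Set.Ici (1 : ℝ)) (R : ℝ), 0 < R →
      μ.real {y | warpedDist S (x, t) (y, t) < R} ≤ C * Real.exp (β * R) / (t : ℝ) ^ k := by
  classical
  obtain ⟨a, ha, hLip⟩ := exists_dist_smul_le_exp_wordLength (Y := Y) hS hLip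
  obtain ⟨C, hC, hball⟩ := exists_measureReal_ball_le μ hk hμ
  set T : Finset Γ := insert 1 (S ∪ S⁻¹)
  have hT : (1 : ℝ) ≤ T.card := by
    exact_mod_cast Finset.card_pos.mpr ⟨1, Finset.mem_insert_self _ _⟩
  have : 0 ≤ Real.log T.card := Real.log_nonneg hT
  refine ⟨C, Real.log T.card + (a + 1) * k, by positivity, fun x t R hR => ?_⟩
  have ht := level_pos t
  have hcard : ((T ^ ⌊R⌋₊).card : ℝ) ≤ Real.exp (Real.log T.card * R) := by
    calc ((T ^ ⌊R⌋₊).card : ℝ) ≤ (T.card : ℝ) ^ ⌊R⌋₊ := by exact_mod_cast Finset.card_pow_le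
      _ ≤ (T.card : ℝ) ^ R := by
          rw [← Real.rpow_natCast]
          exact Real.rpow_le_rpow_of_exponent_le hT (Nat.floor_le hR.le)
      _ = Real.exp (Real.log T.card * R) := Real.rpow_def_of_pos (by linarith) R
  have hradius : (R * Real.exp (a * R) / t) ^ k ≤ Real.exp ((a + 1) * k * R) / (t : ℝ) ^ k := by
    calc (R * Real.exp (a * R) / t) ^ k ≤ (Real.exp R * Real.exp (a * R) / t) ^ k := by
          gcongr
          linarith [Real.add_one_le_exp R]
      _ = Real.exp ((a + 1) * k * R) / (t : ℝ) ^ k := by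
          rw [← Real.exp_add, Real.div_rpow (by positivity) ht.le, ← Real.exp_mul]
          ring_nf
  calc μ.real {y | warpedDist S (x, t) (y, t) < R}
      ≤ μ.real (⋃ γ ∈ T ^ ⌊R⌋₊, Metric.ball (γ • x) (R * Real.exp (a * R) / t)) :=
        measureReal_mono (setOf_warpedDist_lt_subset hS ha hLip x t R) (measure_ne_top _ _)
    _ ≤ ∑ γ ∈ T ^ ⌊R⌋₊, μ.real (Metric.ball (γ • x) (R * Real.exp (a * R) / t)) :=
        measureReal_biUnion_finset_le _ _
    _ ≤ (T ^ ⌊R⌋₊).card * (C * (R * Real.exp (a * R) / t) ^ k) := by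
        rw [← nsmul_eq_mul]
        exact Finset.sum_le_card_nsmul _ _ _ fun γ _ => hball _ _ (by positivity)
    _ ≤ Real.exp (Real.log T.card * R) *
          (C * (Real.exp ((a + 1) * k * R) / (t : ℝ) ^ k)) := by gcongr
    _ = C * Real.exp ((Real.log T.card + (a + 1) * k) * R) / (t : ℝ) ^ k := by
        rw [add_mul (Real.log _), Real.exp_add]
        ring

theorem exists_log_le_mul_of_le_measureReal_warpedBall
    (hS : Subgroup.closure (S : Set Γ) = ⊤) {k : ℝ}
    (hk : 0 < k) (hLip : ∀ γ : Γ, ∃ L : ℝ≥0, LipschitzWith L (fun y : Y => γ • y))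
    (hμ : (fun r : ℝ => ⨆ y : Y, μ.real (Metric.ball y r)) =O[𝓝[>] 0] (fun r : ℝ => r ^ k))
    {δ : ℝ} (hδ : 0 < δ) :
    ∃ K : ℝ, 0 < K ∧ ∀ (x : Y) (t : Set.Ici (1 : ℝ)) (R : ℝ), 1 ≤ R →
      δ ≤ μ.real {y | warpedDist S (x, t) (y, t) < R} → Real.log t ≤ K * R := by
  obtain ⟨C, β, hβ, hball⟩ := exists_measureReal_warpedBall_le μ hS hk.le hLip hμ
  refine ⟨(|Real.log (C / δ)| + β) / k + 1, by positivity, fun x t R hR hmass => ?_⟩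
  have ht := level_pos t
  have htk : δ * (t : ℝ) ^ k ≤ C * Real.exp (β * R) := by
    rw [← le_div_iff₀ (by positivity)]
    exact hmass.trans (hball x t R (by linarith))
  have hC : 0 < C := pos_of_mul_pos_left ((by positivity : 0 < δ * (t : ℝ) ^ k).trans_le htk)
    (Real.exp_nonneg _)
  have hlog : k * Real.log t ≤ Real.log (C / δ) + β * R := by
    have h : (t : ℝ) ^ k ≤ C / δ * Real.exp (β * R) := by
      rwa [div_mul_eq_mul_div, le_div_iff₀' hδ]
    simpa only [Real.log_rpow ht, Real.log_mul (div_pos hC hδ).ne' (Real.exp_ne_zero _),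
      Real.log_exp] using Real.log_le_log (by positivity) h
  have habs : Real.log (C / δ) ≤ |Real.log (C / δ)| * R :=
    (le_abs_self _).trans (le_mul_of_one_le_right (abs_nonneg _) hR)
  calc Real.log t ≤ (|Real.log (C / δ)| + β) * R / k := by
        rw [le_div_iff₀' hk]
        linarith
    _ ≤ ((|Real.log (C / δ)| + β) / k + 1) * R := by
        rw [add_mul _ 1 R, div_mul_eq_mul_div]
        linarith

end WarpedBall

section SpectralGap

theorem half_le_measureReal_lt_of_integral_le {Ω : Type*} [MeasurableSpace Ω] {μ : Measure Ω}
    [IsProbabilityMeasure μ] {g : Ω → ℝ} (hg : 0 ≤ g) (hint : Integrable g μ) {c : ℝ} (hc : 0 < c)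
    (h : ∫ ω, g ω ∂μ ≤ c) : 1 / 2 ≤ μ.real {ω | g ω < 2 * c} := by
  have hmarkov : 2 * c * μ.real {ω | 2 * c ≤ g ω} ≤ c :=
    (mul_meas_ge_le_integral_of_nonneg (ae_of_all μ hg) hint _).trans h
  have hlarge : μ.real {ω | 2 * c ≤ g ω} ≤ 1 / 2 := by
    rw [← le_div_iff₀' (by positivity)] at hmarkov
    exact hmarkov.trans_eq (by field_simp)
  have hunion : 1 ≤ μ.real {ω | g ω < 2 * c} + μ.real {ω | 2 * c ≤ g ω} := by
    calc (1 : ℝ) = μ.real ({ω | g ω < 2 * c} ∪ {ω | 2 * c ≤ g ω}) := by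
          rw [← Set.ofPred_or]
          simp [lt_or_ge]
      _ ≤ _ := measureReal_union_le _ _
  linarith

namespace HasSpectralGap

variable {Γ Y E : Type*} [Group Γ] [MulAction Γ Y] [MeasurableSpace Y] {S : Finset Γ}
  {μ : Measure Y} [IsProbabilityMeasure μ] {p : ℝ≥0∞} [NormedAddCommGroup E] [NormedSpace ℝ E]
  [CompleteSpace E]

theorem exists_integral_norm_sub_integral_le (hgap : HasSpectralGap S μ p E) (hp : 1 ≤ p) :
    ∃ C : ℝ≥0, 0 < C ∧ ∀ (F : Y → E) (b : ℝ≥0), MemLp F p μ →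
      (∀ s ∈ S, ∀ y, ‖F y - F (s⁻¹ • y)‖ ≤ b) → ∫ y, ‖F y - ∫ z, F z ∂μ‖ ∂μ ≤ C * b := by
  obtain ⟨κ, hκ, hgap⟩ := hgap
  lift κ to ℝ≥0 using hκ.le
  have hκ : 0 < κ := by exact_mod_cast hκ
  refine ⟨κ⁻¹, inv_pos.mpr hκ, fun F b hF hb => ?_⟩
  set G : Y → E := fun y => F y - ∫ z, F z ∂μ with hGdef
  have hG : MemLp G p μ := hF.sub (memLp_const _)
  have hmean : ∫ y, G y ∂μ = 0 := by
    rw [hGdef, integral_sub (hF.integrable hp) (integrable_const _)]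
    simp
  have hdisp : ⨆ s ∈ S, eLpNorm (fun y => G y - G (s⁻¹ • y)) p μ ≤ b := by
    refine iSup₂_le fun s hs => ?_
    refine (eLpNorm_le_of_ae_bound (C := b) (ae_of_all _ fun y => ?_)).trans (by simp)
    simpa [hGdef] using hb s hs y
  have hnorm : κ * eLpNorm G 1 μ ≤ b := by
    calc κ * eLpNorm G 1 μ ≤ κ * eLpNorm G p μ := by
          gcongr
          exact eLpNorm_le_eLpNorm_of_exponent_le hp hG.aestronglyMeasurable
      _ ≤ b := by simpa using (hgap G hG hmean).trans hdisp
  rw [eLpNorm_one_eq_lintegral_enorm, ← ofReal_integral_norm_eq_lintegral_enorm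
    (hG.integrable hp)] at hnorm
  have hreal := ENNReal.toReal_mono ENNReal.coe_ne_top hnorm
  rw [ENNReal.toReal_mul, ENNReal.toReal_ofReal (by positivity)] at hreal
  rw [NNReal.coe_inv, le_inv_mul_iff₀ (by exact_mod_cast hκ)]
  simpa using hreal

theorem exists_half_le_measureReal_norm_sub_lt (hgap : HasSpectralGap S μ p E) (hp : 1 ≤ p) :
    ∃ C : ℝ≥0, ∀ (F : Y → E) (b : ℝ≥0), 0 < b → MemLp F p μ →
      (∀ s ∈ S, ∀ y, ‖F y - F (s⁻¹ • y)‖ ≤ b) →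
      ∃ m : E, 1 / 2 ≤ μ.real {y | ‖F y - m‖ < C * b} := by
  obtain ⟨C, hC, hmean⟩ := hgap.exists_integral_norm_sub_integral_le hp
  refine ⟨2 * C, fun F b hb hF hdisp => ⟨∫ z, F z ∂μ, ?_⟩⟩
  have hint : Integrable (fun y => ‖F y - ∫ z, F z ∂μ‖) μ :=
    ((hF.integrable hp).sub (integrable_const _)).norm
  simpa [mul_assoc] using half_le_measureReal_lt_of_integral_le (fun _ => norm_nonneg _) hint
    (by positivity) (hmean F b hF hdisp)

end HasSpectralGap

theorem exists_simpleFunc_forall_dist_le {X : Type*} [PseudoMetricSpace X] [MeasurableSpace X]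
    [OpensMeasurableSpace X] (Z : Set X) [Finite Z] [Nonempty Z] :
    ∃ g : SimpleFunc X Z, ∀ (x : X) (z : Z), dist (g x : X) x ≤ dist (z : X) x := by
  obtain ⟨e, he⟩ := exists_surjective_nat Z
  obtain ⟨N, hN⟩ := (Set.finite_range (Function.surjInv he)).bddAbove
  refine ⟨(SimpleFunc.nearestPtInd (fun k => (e k : X)) N).map e, fun x z => ?_⟩
  have hnearest := SimpleFunc.edist_nearestPt_le (fun k => (e k : X)) x (hN ⟨z, rfl⟩)
  rw [Function.surjInv_eq he] at hnearest
  simpa [edist_dist, SimpleFunc.nearestPt] using hnearest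

theorem exists_simpleFunc_dist_le {Y X : Type*} [TopologicalSpace Y] [Nonempty Y]
    [MeasurableSpace Y] [OpensMeasurableSpace Y] [PseudoMetricSpace X] {φ : Y → X}
    (hφ : Continuous φ) {Z : Set X} (hfin : Z.Finite) {r : ℝ}
    (hnet : ∀ y, ∃ z ∈ Z, dist z (φ y) ≤ r) :
    ∃ z : SimpleFunc Y Z, ∀ y, dist (z y : X) (φ y) ≤ r := by
  have := hfin.to_subtype
  obtain ⟨y₀⟩ := ‹Nonempty Y›
  have : Nonempty Z := let ⟨z, hz, _⟩ := hnet y₀; ⟨⟨z, hz⟩⟩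
  borelize X
  obtain ⟨g, hg⟩ := exists_simpleFunc_forall_dist_le Z
  exact ⟨g.comp φ hφ.measurable, fun y =>
    let ⟨z, hz, h⟩ := hnet y; (hg (φ y) ⟨z, hz⟩).trans h⟩

theorem HasSpectralGap.exists_half_le_measureReal_dist_lt {Γ Y X E : Type*} [Group Γ]
    [MulAction Γ Y] [TopologicalSpace Y] [MeasurableSpace Y] [OpensMeasurableSpace Y] {S : Finset Γ}
    {μ : Measure Y} [IsProbabilityMeasure μ] {p : ℝ≥0∞} [PseudoMetricSpace X]
    [NormedAddCommGroup E] [NormedSpace ℝ E] [CompleteSpace E] (hgap : HasSpectralGap S μ p E)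
    (hp : 1 ≤ p) :
    ∃ C : ℝ≥0, ∀ (φ : Y → X) (Z : Set X) (f : Z → E) (L M : ℝ≥0), Continuous φ →
      (∀ s ∈ S, ∀ y, dist (φ y) (φ (s⁻¹ • y)) ≤ 1) → Z.Finite →
      (∀ y, ∃ z ∈ Z, dist z (φ y) ≤ 1) → 0 < L → LipschitzWith L f → AntilipschitzWith M f →
      ∃ x, 1 / 2 ≤ μ.real {y | dist (φ x) (φ y) < C * (L * M) + 3} := by
  have : Nonempty Y := μ.nonempty_of_neZero
  obtain ⟨C, hC⟩ := hgap.exists_half_le_measureReal_norm_sub_lt hp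
  refine ⟨2 * C * 3, fun φ Z f L M hφ hdisp hfin hnet hL hfL hfM => ?_⟩
  obtain ⟨z, hz⟩ := exists_simpleFunc_dist_le hφ hfin hnet
  have hfdisp : ∀ s ∈ S, ∀ y, ‖f (z y) - f (z (s⁻¹ • y))‖ ≤ (3 * L : ℝ≥0) := fun s hs y => by
    have hd : dist (z y) (z (s⁻¹ • y)) ≤ 3 := by
      have h := dist_triangle4 (z y : X) (φ y) (φ (s⁻¹ • y)) (z (s⁻¹ • y))
      rw [dist_comm (φ (s⁻¹ • y))] at h
      rw [Subtype.dist_eq]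
      linarith [hz y, hz (s⁻¹ • y), hdisp s hs y]
    rw [← dist_eq_norm]
    calc dist (f (z y)) (f (z (s⁻¹ • y))) ≤ L * dist (z y) (z (s⁻¹ • y)) := hfL.dist_le_mul _ _
      _ ≤ L * 3 := by gcongr
      _ = (3 * L : ℝ≥0) := by push_cast; ring
  obtain ⟨m, hm⟩ := hC (z.map f) (3 * L) (by positivity)
    ((z.map f).memLp_of_isFiniteMeasure p μ) hfdisp
  obtain ⟨x, hx⟩ := nonempty_of_measureReal_ne_zero (one_half_pos.trans_le hm).ne'
  refine ⟨x, hm.trans (measureReal_mono (fun y hy => ?_) (measure_ne_top _ _))⟩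
  simp only [Set.mem_ofPred_eq, SimpleFunc.map_apply, ← dist_eq_norm] at hx hy ⊢
  have hzxy : dist (z x : X) (z y) ≤ (2 * C * 3 : ℝ≥0) * (L * M) := by
    calc dist (z x : X) (z y) ≤ M * dist (f (z x)) (f (z y)) := hfM.le_mul_dist _ _
      _ ≤ M * (C * (3 * L : ℝ≥0) + C * (3 * L : ℝ≥0)) := by
          gcongr
          exact (dist_triangle_right _ _ m).trans (add_le_add hx.le hy.le)
      _ = (2 * C * 3 : ℝ≥0) * (L * M) := by push_cast; ring
  have h := dist_triangle4 (φ x) (z x : X) (z y) (φ y)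
  rw [dist_comm (φ x) (z x)] at h
  linarith [hz x, hz y]

end SpectralGap

section LowerBound

variable {Γ Y : Type*} [Group Γ] {S : Finset Γ}

namespace WarpedCone

/-- The bijection of `Y` with the level `Y × {t}` of the warped cone. -/
def levelMap (hS : Subgroup.closure (S : Set Γ) = ⊤) (t : Set.Ici (1 : ℝ)) (y : Y) :
    WarpedCone Y S hS :=
  (y, t)

variable [MetricSpace Y] (hS : Subgroup.closure (S : Set Γ) = ⊤) (t : Set.Ici (1 : ℝ))

theorem coneDist_levelMap (x y : Y) :
    coneDist (levelMap hS t x) (levelMap hS t y) = t * dist x y := by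
  simp [levelMap, coneDist]

variable [MulAction Γ Y]

theorem dist_le_coneDist (w w' : WarpedCone Y S hS) : dist w w' ≤ coneDist w w' :=
  (isGreatest_warpedDist hS).1.le_coneDist w w'

theorem continuous_levelMap : Continuous (levelMap hS t : Y → WarpedCone Y S hS) :=
  (LipschitzWith.of_dist_le_mul (K := ⟨t, (level_pos t).le⟩) fun x y =>
    (dist_le_coneDist hS _ _).trans_eq (coneDist_levelMap hS t x y)).continuous

theorem dist_levelMap_smul_le (γ : Γ) (y : Y) :
    dist (levelMap hS t y) (levelMap hS t (γ • y)) ≤ wordLength S γ :=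
  (isGreatest_warpedDist hS).1.le_wordLength γ (y, t)

end WarpedCone

theorem log_le_mul_of_le_mul_pow {N A t K D : ℝ} {n : ℕ} (hN : 0 < N) (ht : 0 < t)
    (h : N ≤ A * t ^ n) (hlog : Real.log t ≤ K * D) (hD : 1 ≤ D) :
    Real.log N ≤ (|Real.log A| + n * K) * D := by
  have hA : 0 < A := pos_of_mul_pos_left (hN.trans_le h) (by positivity)
  calc Real.log N ≤ Real.log (A * t ^ n) := Real.log_le_log hN h
    _ = Real.log A + n * Real.log t := by rw [Real.log_mul hA.ne' (by positivity), Real.log_pow]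
    _ ≤ |Real.log A| * D + n * (K * D) := by
        gcongr
        exact (le_abs_self _).trans (le_mul_of_one_le_right (abs_nonneg _) hD)
    _ = (|Real.log A| + n * K) * D := by ring

theorem exists_log_le_distortion [MetricSpace Y] [MulAction Γ Y] [MeasurableSpace Y]
    [OpensMeasurableSpace Y] {μ : Measure Y} [IsProbabilityMeasure μ]
    (hS : Subgroup.closure (S : Set Γ) = ⊤) (n : ℕ) {k : ℝ}
    (hk : 0 < k) (hLip : ∀ γ : Γ, ∃ L : ℝ≥0, LipschitzWith L (fun y : Y => γ • y))
    (hμ : (fun r : ℝ => ⨆ y : Y, μ.real (Metric.ball y r)) =O[𝓝[>] 0] (fun r : ℝ => r ^ k))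
    {E : Type*} [NormedAddCommGroup E] [NormedSpace ℝ E] [CompleteSpace E] {p : ℝ≥0∞}
    (hp : 1 ≤ p) (hgap : HasSpectralGap S μ p E) (A : ℝ) :
    ∃ c : ℝ, 0 < c ∧ ∀ (t : Set.Ici (1 : ℝ)) (Z : Set (WarpedCone Y S hS)),
      Z.Finite → IsNet dist 1 (WarpedCone.level t) Z → (Z.ncard : ℝ) ≤ A * (t : ℝ) ^ n →
      ENNReal.ofReal (c * Real.log Z.ncard) ≤ distortion E Z := by
  obtain ⟨C, hconc⟩ := hgap.exists_half_le_measureReal_dist_lt (X := WarpedCone Y S hS) hp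
  obtain ⟨K, hK, hball⟩ :=
    exists_log_le_mul_of_le_measureReal_warpedBall μ hS hk hLip hμ one_half_pos
  set d := |Real.log A| + n * (K * (C + 3)) + 1
  refine ⟨d⁻¹, by positivity, fun t Z hfin hZ hcard => ?_⟩
  have := hfin.to_subtype
  rcases Set.subsingleton_or_nontrivial Z with hsub | hnt
  · have hle : Z.ncard ≤ 1 := Set.ncard_le_one_iff_subsingleton.mpr hsub
    interval_cases Z.ncard <;> simp
  have : Nontrivial Z := hnt.coe_sort
  refine le_iInf₂ fun f hf => ?_
  obtain ⟨L, M, hL, hM, hLM⟩ := hf.exists_mapDistortion_eq_mul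
  have hD : 1 ≤ L * M := one_le_mul_of_lipschitzWith_of_antilipschitzWith hL hM
  have hD' : (1 : ℝ) ≤ L * M := by exact_mod_cast hD
  obtain ⟨x, hx⟩ := hconc (WarpedCone.levelMap hS t) Z f L M (WarpedCone.continuous_levelMap hS t)
    (fun s hs y => (WarpedCone.dist_levelMap_smul_le hS t s⁻¹ y).trans
      (by exact_mod_cast wordLength_inv_le_one hs)) hfin (fun y => hZ.2 _ rfl)
    (pos_of_mul_pos_left (one_pos.trans_le hD) M.2) hL hM
  have hCD : 0 ≤ C * (L * M : ℝ) := by positivity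
  have hR : C * (L * M) + 3 ≤ (C + 3) * (L * M : ℝ) := by linarith
  have hlog : Real.log t ≤ K * (C + 3) * (L * M) := by
    rw [mul_assoc]
    exact (hball x t _ (by linarith) hx).trans (by gcongr)
  rw [hLM, ← ENNReal.coe_mul, ENNReal.coe_nnreal_eq]
  refine ENNReal.ofReal_le_ofReal ?_
  rw [inv_mul_le_iff₀ (by positivity), NNReal.coe_mul]
  refine (log_le_mul_of_le_mul_pow (by exact_mod_cast (Set.ncard_pos hfin).mpr hnt.nonempty)
    (level_pos t) hcard hlog hD').trans ?_
  gcongr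
  exact (lt_add_one _).le

end LowerBound

section Nets

theorem exists_finset_isSeparated_isCover (X : Type*) [PseudoEMetricSpace X] [CompactSpace X]
    {ε : ℝ≥0} (hε : 0 < ε) :
    ∃ N : Finset X, Metric.IsSeparated ε (N : Set X) ∧ Metric.IsCover ε Set.univ (N : Set X) := by
  obtain ⟨T, -, hTfin, hT⟩ := Metric.exists_finite_isCover_of_isCompact (half_pos hε).ne'
    (isCompact_univ (X := X))
  have hpack : Metric.packingNumber ε (Set.univ : Set X) ≠ ⊤ := by
    have h := (Metric.packingNumber_two_mul_le_externalCoveringNumber (ε / 2) Set.univ).trans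
      hT.externalCoveringNumber_le_encard
    rw [mul_div_cancel₀ ε two_ne_zero] at h
    exact ne_top_of_le_ne_top (Set.encard_ne_top_iff.mpr hTfin) h
  obtain ⟨N, hN⟩ := (Set.encard_ne_top_iff.mp
    ((Metric.encard_maximalSeparatedSet hpack).trans_ne hpack)).exists_finset_coe
  exact ⟨N, hN ▸ Metric.isSeparated_maximalSeparatedSet,
    hN ▸ Metric.isCover_maximalSeparatedSet hpack⟩

section Image

variable {X Z : Type*} [PseudoEMetricSpace X] [PseudoEMetricSpace Z] {f : X → Z} {s N : Set X}
  {K ε : ℝ≥0}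

theorem isCover_image_of_lipschitzOnWith (hf : LipschitzOnWith K f s) (hNs : N ⊆ s)
    (hN : Metric.IsCover ε s N) : Metric.IsCover (K * ε) (f '' s) (f '' N) := by
  rintro _ ⟨x, hx, rfl⟩
  obtain ⟨y, hy, hxy⟩ := hN hx
  refine ⟨f y, Set.mem_image_of_mem f hy, (hf hx (hNs hy)).trans ?_⟩
  rw [ENNReal.coe_mul]
  gcongr
  exact hxy

theorem isSeparated_image_of_lipschitzOnWith_leftInvOn {g : Z → X}
    (hg : LipschitzOnWith K g (f '' N)) (hgf : Set.LeftInvOn g f N)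
    (hN : Metric.IsSeparated ((K * ε : ℝ≥0) : ℝ≥0∞) N) : Metric.IsSeparated ε (f '' N) := by
  rintro _ ⟨x, hx, rfl⟩ _ ⟨y, hy, rfl⟩ hne
  by_contra! hle
  have hxy := hg (Set.mem_image_of_mem f hx) (Set.mem_image_of_mem f hy)
  rw [hgf hx, hgf hy] at hxy
  refine (hN hx hy (ne_of_apply_ne f hne)).not_ge (hxy.trans ?_)
  rw [ENNReal.coe_mul]
  gcongr

end Image

section Volume

variable {V : Type*} [NormedAddCommGroup V] [NormedSpace ℝ V] [FiniteDimensional ℝ V]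
  {N : Finset V} {c : V}

open Module

theorem pow_finrank_le_card_mul_of_isCover {ρ : ℝ} (hρ : 0 < ρ) {r : ℝ≥0}
    (hN : Metric.IsCover r (Metric.ball c ρ) (N : Set V)) :
    ρ ^ finrank ℝ V ≤ N.card * (r : ℝ) ^ finrank ℝ V := by
  borelize V
  let μ : Measure V := Measure.addHaar
  have hvol := (measure_mono hN.subset_iUnion_closedBall).trans
    (measure_biUnion_finset_le (μ := μ) N fun y => Metric.closedBall y (r : ℝ))
  simp only [μ.addHaar_ball_of_pos _ hρ, μ.addHaar_closedBall _ r.coe_nonneg, Finset.sum_const,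
    nsmul_eq_mul] at hvol
  rw [← mul_assoc, ENNReal.mul_le_mul_iff_left (Metric.measure_ball_pos μ _ one_pos).ne'
    measure_ball_lt_top.ne, ← ENNReal.ofReal_natCast, ← ENNReal.ofReal_mul (by positivity),
    ENNReal.ofReal_le_ofReal_iff (by positivity)] at hvol
  exact hvol

theorem card_mul_pow_finrank_le_of_isSeparated {ρ r : ℝ≥0}
    (hball : (N : Set V) ⊆ Metric.closedBall c ρ)
    (hN : Metric.IsSeparated ((2 * r : ℝ≥0) : ℝ≥0∞) (N : Set V)) :
    N.card * (r : ℝ) ^ finrank ℝ V ≤ (ρ + r : ℝ) ^ finrank ℝ V := by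
  borelize V
  let μ : Measure V := Measure.addHaar
  have hdisj : (N : Set V).PairwiseDisjoint fun x => Metric.closedBall x (r : ℝ) :=
    fun x hx y hy hxy => Metric.closedBall_disjoint_closedBall <| by
      have hlt : ((2 * r : ℝ≥0) : ℝ≥0∞) < edist x y := hN hx hy hxy
      rw [edist_nndist, ENNReal.coe_lt_coe, ← NNReal.coe_lt_coe, coe_nndist, NNReal.coe_mul,
        NNReal.coe_ofNat] at hlt
      linarith
  have hincl : ⋃ x ∈ N, Metric.closedBall x (r : ℝ) ⊆ Metric.closedBall c (ρ + r) :=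
    Set.iUnion₂_subset fun x hx => Metric.closedBall_subset_closedBall' <| by
      linarith [Metric.mem_closedBall.mp (hball hx)]
  have hvol := measure_mono (μ := μ) hincl
  rw [measure_biUnion_finset hdisj fun _ _ => Metric.isClosed_closedBall.measurableSet] at hvol
  simp only [μ.addHaar_closedBall _ r.coe_nonneg,
    μ.addHaar_closedBall c (add_nonneg ρ.coe_nonneg r.coe_nonneg), Finset.sum_const,
    nsmul_eq_mul] at hvol
  rw [← mul_assoc, ENNReal.mul_le_mul_iff_left (Metric.measure_ball_pos μ _ one_pos).ne'
    measure_ball_lt_top.ne, ← ENNReal.ofReal_natCast, ← ENNReal.ofReal_mul (by positivity),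
    ENNReal.ofReal_le_ofReal_iff (by positivity)] at hvol
  exact hvol

theorem exists_card_mul_pow_finrank_le_of_leftInvOn {X : Type*} [PseudoEMetricSpace X] {f : X → V}
    {g : V → X} {s : Set X} {K : ℝ≥0} (hs : Bornology.IsBounded (f '' s))
    (hg : LipschitzOnWith K g (f '' s)) (hgf : Set.LeftInvOn g f s) :
    ∃ b : ℝ, ∀ ε : ℝ≥0, ε ≤ 1 → ∀ N : Finset X, (N : Set X) ⊆ s →
      Metric.IsSeparated ε (N : Set X) → N.card * (ε : ℝ) ^ finrank ℝ V ≤ b := by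
  classical
  obtain ⟨ρ, hρ⟩ := hs.subset_closedBall 0
  set K' := K + 1
  refine ⟨(2 * K' * ρ.toNNReal + 1) ^ finrank ℝ V, fun ε hε N hNs hN => ?_⟩
  have hK'pos : 0 < K' := by positivity
  have hε' : K' * (2 * (ε / (2 * K'))) = ε := by field_simp
  have hK' : LipschitzOnWith K' g (f '' N) := (hg.weaken le_self_add).mono (Set.image_mono hNs)
  have hcard := card_mul_pow_finrank_le_of_isSeparated (N := N.image f) (c := 0)
    (ρ := ρ.toNNReal) (r := ε / (2 * K'))
    (by
      rw [Finset.coe_image]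
      exact ((Set.image_mono hNs).trans hρ).trans
        (Metric.closedBall_subset_closedBall (Real.le_coe_toNNReal ρ)))
    (by
      rw [Finset.coe_image]
      exact isSeparated_image_of_lipschitzOnWith_leftInvOn hK' (hgf.mono hNs) (by rwa [hε']))
  rw [Finset.card_image_of_injOn (hgf.mono hNs).injOn] at hcard
  calc N.card * (ε : ℝ) ^ finrank ℝ V
      = (2 * K') ^ finrank ℝ V * (N.card * ((ε / (2 * K') : ℝ≥0) : ℝ) ^ finrank ℝ V) := by
        rw [mul_left_comm, ← mul_pow]
        push_cast
        field_simp
    _ ≤ (2 * K') ^ finrank ℝ V * (ρ.toNNReal + (ε / (2 * K') : ℝ≥0)) ^ finrank ℝ V := by gcongr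
    _ = (2 * K' * ρ.toNNReal + ε) ^ finrank ℝ V := by
        rw [← mul_pow]
        push_cast
        field_simp
    _ ≤ (2 * K' * ρ.toNNReal + 1) ^ finrank ℝ V := by
        gcongr
        exact_mod_cast hε

end Volume

namespace IsMetricManifold

variable {n : ℕ} {Y : Type*} [MetricSpace Y]

theorem exists_le_card_mul_pow_of_isCover [Nonempty Y] (hY : IsMetricManifold n Y) :
    ∃ a : ℝ, 0 < a ∧ ∀ (ε : ℝ≥0) (N : Finset Y), Metric.IsCover ε Set.univ (N : Set Y) →
      a ≤ N.card * (ε : ℝ) ^ n := by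
  classical
  obtain ⟨y⟩ := ‹Nonempty Y›
  obtain ⟨e, hy, K, hK, -⟩ := hY y
  obtain ⟨ρ, hρ, hball⟩ := Metric.isOpen_iff.mp e.open_target (e y) (e.map_source hy)
  refine ⟨(ρ / (2 * (K + 1))) ^ n, by positivity, fun ε N hN => ?_⟩
  have hcov : Metric.coveringNumber (2 * ε) e.source ≤ N.card := by
    simpa using (Metric.coveringNumber_two_mul_le_externalCoveringNumber ε e.source).trans
      (hN.anti (Set.subset_univ _)).externalCoveringNumber_le_encard
  obtain ⟨M, hMs, hMfin, hM, hMcard⟩ :=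
    Metric.exists_set_encard_eq_coveringNumber (ne_top_of_le_ne_top (by simp) hcov)
  lift M to Finset Y using hMfin
  have hMN : (M.image e).card ≤ N.card := by
    refine Finset.card_image_le.trans ?_
    rwa [← hMcard, Set.encard_coe_eq_coe_finsetCard, Nat.cast_le] at hcov
  have himage := isCover_image_of_lipschitzOnWith (hK.weaken (K' := K + 1) le_self_add) hMs hM
  rw [e.image_source_eq_target, ← Finset.coe_image] at himage
  have hvol := pow_finrank_le_card_mul_of_isCover hρ (himage.anti hball)
  rw [finrank_euclideanSpace_fin] at hvol
  rw [div_pow, div_le_iff₀ (by positivity)]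
  calc ρ ^ n ≤ (M.image e).card * (((K + 1) * (2 * ε) : ℝ≥0) : ℝ) ^ n := hvol
    _ ≤ N.card * (((K + 1) * (2 * ε) : ℝ≥0) : ℝ) ^ n := by gcongr
    _ = N.card * (ε : ℝ) ^ n * (2 * (K + 1)) ^ n := by
        rw [mul_assoc, ← mul_pow]
        push_cast
        ring_nf

theorem exists_card_mul_pow_le_of_isSeparated [CompactSpace Y] (hY : IsMetricManifold n Y) :
    ∃ b : ℝ, ∀ ε : ℝ≥0, ε ≤ 1 → ∀ N : Finset Y, Metric.IsSeparated ε (N : Set Y) →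
      N.card * (ε : ℝ) ^ n ≤ b := by
  classical
  choose e hmem K hK hK' using hY
  obtain ⟨T, -, hT⟩ := isCompact_univ.elim_nhds_subcover (fun y => (e y).source)
    fun y _ => (e y).open_source.mem_nhds (hmem y)
  have hchart : ∀ y, ∃ b : ℝ, ∀ ε : ℝ≥0, ε ≤ 1 → ∀ N : Finset Y, (N : Set Y) ⊆ (e y).source →
      Metric.IsSeparated ε (N : Set Y) → N.card * (ε : ℝ) ^ n ≤ b := fun y => by
    have hbdd : Bornology.IsBounded (e y '' (e y).source) := by
      rw [← Set.range_domRestrict, ← Set.image_univ]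
      exact (hK y).to_restrict.isBounded_image (Bornology.IsBounded.all _)
    simpa using exists_card_mul_pow_finrank_le_of_leftInvOn hbdd
      ((e y).image_source_eq_target ▸ hK' y) (e y).leftInvOn
  choose b hb using hchart
  refine ⟨∑ y ∈ T, b y, fun ε hε N hN => ?_⟩
  have hcover : N ⊆ T.biUnion fun y => N.filter (· ∈ (e y).source) := fun x hx => by
    obtain ⟨y, hy, hxy⟩ := Set.mem_iUnion₂.mp (hT (Set.mem_univ x))
    exact Finset.mem_biUnion.mpr ⟨y, hy, Finset.mem_filter.mpr ⟨hx, hxy⟩⟩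
  calc N.card * (ε : ℝ) ^ n ≤ (∑ y ∈ T, ((N.filter (· ∈ (e y).source)).card : ℝ)) * ε ^ n := by
        gcongr
        exact_mod_cast (Finset.card_le_card hcover).trans Finset.card_biUnion_le
    _ = ∑ y ∈ T, (N.filter (· ∈ (e y).source)).card * (ε : ℝ) ^ n := Finset.sum_mul ..
    _ ≤ ∑ y ∈ T, b y := Finset.sum_le_sum fun y _ => hb y ε hε _
        (fun x hx => (Finset.mem_filter.mp hx).2) (hN.subset (Finset.filter_subset _ _))

end IsMetricManifold

theorem WarpedCone.isNet_coneDist_image_levelMap {Γ Y : Type*} [Group Γ] [MetricSpace Y]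
    {S : Finset Γ} (hS : Subgroup.closure (S : Set Γ) = ⊤) (t : Set.Ici (1 : ℝ)) {ε : ℝ≥0}
    {N : Set Y} (hN : Metric.IsCover ε Set.univ N) :
    IsNet (X := WarpedCone Y S hS) coneDist (t * ε) (level t) (levelMap hS t '' N) := by
  refine ⟨Set.image_subset_iff.mpr fun y _ => rfl, ?_⟩
  rintro ⟨y, _⟩ rfl
  obtain ⟨x, hx, hyx⟩ := hN (Set.mem_univ y)
  refine ⟨_, Set.mem_image_of_mem _ hx, (coneDist_levelMap hS _ x y).trans_le ?_⟩
  have hxy : edist x y ≤ ε := edist_comm x y ▸ hyx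
  gcongr
  · exact (level_pos _).le
  · rwa [edist_le_coe, ← NNReal.coe_le_coe, coe_nndist] at hxy

theorem IsMetricManifold.exists_net_level {Γ Y : Type*} [Group Γ] [MetricSpace Y] [CompactSpace Y]
    [Nonempty Y] [MulAction Γ Y] {S : Finset Γ} {n : ℕ} (hY : IsMetricManifold n Y)
    (hS : Subgroup.closure (S : Set Γ) = ⊤) :
    ∃ a b : ℝ, 0 < a ∧ 0 < b ∧ ∀ t : Set.Ici (1 : ℝ), ∃ Z : Set (WarpedCone Y S hS),
      Z.Finite ∧ IsNet (X := WarpedCone Y S hS) coneDist 1 (WarpedCone.level t) Z ∧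
      IsNet dist 1 (WarpedCone.level t) Z ∧
      a * (t : ℝ) ^ n ≤ Z.ncard ∧ (Z.ncard : ℝ) ≤ b * (t : ℝ) ^ n := by
  obtain ⟨a, ha, hlow⟩ := hY.exists_le_card_mul_pow_of_isCover
  obtain ⟨b, hup⟩ := hY.exists_card_mul_pow_le_of_isSeparated
  refine ⟨a, max b 1, ha, by positivity, fun t => ?_⟩
  have ht := level_pos t
  obtain ⟨ε, hε⟩ : ∃ ε : ℝ≥0, (ε : ℝ) = (t : ℝ)⁻¹ := CanLift.prf _ (inv_nonneg.mpr ht.le)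
  have hε0 : 0 < ε := by
    rw [← NNReal.coe_pos, hε]
    positivity
  have hε1 : ε ≤ 1 := by
    rw [← NNReal.coe_le_one, hε]
    exact inv_le_one_of_one_le₀ t.2
  obtain ⟨N, hsep, hcover⟩ := exists_finset_isSeparated_isCover Y hε0
  have hnet := WarpedCone.isNet_coneDist_image_levelMap hS t hcover
  rw [hε, mul_inv_cancel₀ ht.ne'] at hnet
  have hinj : Function.Injective (WarpedCone.levelMap hS t : Y → WarpedCone Y S hS) :=
    fun _ _ hxy => congrArg Prod.fst hxy
  have hnetdist : IsNet dist 1 (WarpedCone.level t) (WarpedCone.levelMap hS t '' N) :=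
    ⟨hnet.1, fun w hw => let ⟨z, hz, hzw⟩ := hnet.2 w hw
      ⟨z, hz, (WarpedCone.dist_le_coneDist hS z w).trans hzw⟩⟩
  refine ⟨_, N.finite_toSet.image _, hnet, hnetdist, ?_, ?_⟩ <;>
    rw [Set.ncard_image_of_injective _ hinj, Set.ncard_coe_finset]
  · have h := hlow ε N hcover
    rwa [hε, inv_pow, ← div_eq_mul_inv, le_div_iff₀ (by positivity)] at h
  · have h := (hup ε hε1 N hsep).trans (le_max_left b 1)
    rwa [hε, inv_pow, ← div_eq_mul_inv, div_le_iff₀ (by positivity)] at h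

end Nets

theorem mainTheorem3_general :
    ∃ C : ℝ, 0 < C ∧
    ∀ (Y : Type*) [MetricSpace Y] [MeasurableSpace Y] [OpensMeasurableSpace Y]
      (μ : Measure Y) [IsProbabilityMeasure μ]
      (Γ : Type*) [Group Γ] [MulAction Γ Y]
      (S : Finset Γ) (hS : Subgroup.closure (S : Set Γ) = ⊤)
      (n : ℕ) (k : ℝ),
      (∀ γ : Γ, ∃ L : ℝ≥0, LipschitzWith L (fun y : Y => γ • y)) →
      0 < k →
      (fun r : ℝ => ⨆ y : Y, μ.real (Metric.ball y r)) =O[𝓝[>] 0] (fun r : ℝ => r ^ k) →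
      (CompactSpace Y → IsMetricManifold n Y →
        ∃ a b : ℝ, 0 < a ∧ 0 < b ∧ ∀ t : Set.Ici (1 : ℝ), ∃ Z : Set (WarpedCone Y S hS),
        Z.Finite ∧ IsNet (X := WarpedCone Y S hS) coneDist 1 (WarpedCone.level t) Z ∧
        IsNet dist 1 (WarpedCone.level t) Z ∧
        a * (t : ℝ) ^ n ≤ Z.ncard ∧ (Z.ncard : ℝ) ≤ b * (t : ℝ) ^ n) ∧
      (∀ (E : Type*) [NormedAddCommGroup E] [NormedSpace ℝ E] [CompleteSpace E]
        (p : ℝ≥0∞), 1 ≤ p → HasSpectralGap S μ p E →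
        ∀ A : ℝ, ∃ c : ℝ, 0 < c ∧ ∀ (t : Set.Ici (1 : ℝ)) (Z : Set (WarpedCone Y S hS)),
          Z.Finite → IsNet dist 1 (WarpedCone.level t) Z → (Z.ncard : ℝ) ≤ A * (t : ℝ) ^ n →
          ENNReal.ofReal (c * Real.log Z.ncard) ≤ distortion E Z) ∧
      (∀ p : ℝ≥0∞, 1 ≤ p → HasSpectralGap S μ p (lp (fun _ : ℕ => ℝ) 2) →
        ∀ A : ℝ, ∃ c : ℝ, 0 < c ∧ ∀ (t : Set.Ici (1 : ℝ)) (Z : Set (WarpedCone Y S hS)),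
          Z.Finite → IsNet dist 1 (WarpedCone.level t) Z → (Z.ncard : ℝ) ≤ A * (t : ℝ) ^ n →
          ENNReal.ofReal (c * Real.log Z.ncard) ≤ distortion (lp (fun _ : ℕ => ℝ) 2) Z ∧
          distortion (lp (fun _ : ℕ => ℝ) 2) Z ≤ ENNReal.ofReal (C * Real.log Z.ncard)) := by
  refine ⟨48 / Real.log 2, by positivity, ?_⟩
  intro Y _ _ _ μ _ Γ _ _ S hS n k hLip hk hμ
  have : Nonempty Y := μ.nonempty_of_neZero
  refine ⟨fun _ hY => hY.exists_net_level hS, fun E _ _ _ p hp hgap A => ?_,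
    fun p hp hgap A => ?_⟩
  · exact exists_log_le_distortion hS n hk hLip hμ hp hgap A
  · obtain ⟨c, hc, hlow⟩ := exists_log_le_distortion hS n hk hLip hμ hp hgap A
    refine ⟨c, hc, fun t Z hfin hZ hcard => ⟨hlow t Z hfin hZ hcard, ?_⟩⟩
    have := hfin.to_subtype
    exact distortion_lp_le_log Z

/-- `C` is the universal constant of the logarithmic upper bound for the Euclidean distortion;
`a`, `b` and `c` do not depend on the level `t` and the net `Z`. -/
theorem mainTheorem3 :
    ∃ C : ℝ, 0 < C ∧
    ∀ (Y : Type*) [MetricSpace Y] [CompactSpace Y] [MeasurableSpace Y] [BorelSpace Y]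
      (μ : Measure Y) [IsProbabilityMeasure μ]
      (Γ : Type*) [Group Γ] [MulAction Γ Y]
      (S : Finset Γ) (hS : Subgroup.closure (S : Set Γ) = ⊤)
      (n : ℕ) (k : ℝ),
      (∀ x y : Y, dist x y ≤ 1) →
      IsMetricManifold n Y →
      (∀ γ : Γ, MeasurePreserving (fun y : Y => γ • y) μ μ) →
      (∀ γ : Γ, ∃ L : ℝ≥0, LipschitzWith L (fun y : Y => γ • y)) →
      0 < k →
      (fun r : ℝ => ⨆ y : Y, μ.real (Metric.ball y r)) =O[𝓝[>] 0] (fun r : ℝ => r ^ k) →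
      -- existence of 1-nets of the levels with cardinality of order `t ^ n`
      (∃ a b : ℝ, 0 < a ∧ 0 < b ∧ ∀ t : Set.Ici (1 : ℝ), ∃ Z : Set (WarpedCone Y S hS),
        Z.Finite ∧ IsNet (X := WarpedCone Y S hS) coneDist 1 (WarpedCone.level t) Z ∧
        IsNet dist 1 (WarpedCone.level t) Z ∧
        a * (t : ℝ) ^ n ≤ Z.ncard ∧ (Z.ncard : ℝ) ≤ b * (t : ℝ) ^ n) ∧
      -- the lower bound for the distortion of all such nets
      (∀ (E : Type*) [NormedAddCommGroup E] [NormedSpace ℝ E] [CompleteSpace E]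
        (p : ℝ≥0∞), 1 < p → p ≠ ∞ → HasSpectralGap S μ p E →
        ∀ A : ℝ, ∃ c : ℝ, 0 < c ∧ ∀ (t : Set.Ici (1 : ℝ)) (Z : Set (WarpedCone Y S hS)),
          Z.Finite → IsNet dist 1 (WarpedCone.level t) Z → (Z.ncard : ℝ) ≤ A * (t : ℝ) ^ n →
          ENNReal.ofReal (c * Real.log Z.ncard) ≤ distortion E Z) ∧
      -- the Euclidean case
      (∀ p : ℝ≥0∞, 1 < p → p ≠ ∞ → HasSpectralGap S μ p (lp (fun _ : ℕ => ℝ) 2) →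
        ∀ A : ℝ, ∃ c : ℝ, 0 < c ∧ ∀ (t : Set.Ici (1 : ℝ)) (Z : Set (WarpedCone Y S hS)),
          Z.Finite → IsNet dist 1 (WarpedCone.level t) Z → (Z.ncard : ℝ) ≤ A * (t : ℝ) ^ n →
          ENNReal.ofReal (c * Real.log Z.ncard) ≤ distortion (lp (fun _ : ℕ => ℝ) 2) Z ∧
          distortion (lp (fun _ : ℕ => ℝ) 2) Z ≤ ENNReal.ofReal (C * Real.log Z.ncard)) := by
  obtain ⟨C, hC, h⟩ := mainTheorem3_general
  exact ⟨C, hC, fun Y _ _ _ _ μ _ Γ _ _ S hS n k _ hY _ hLip hk hμ =>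
    have ⟨hnet, hlow, hlog⟩ := h Y μ Γ S hS n k hLip hk hμ
    ⟨hnet ‹_› hY, fun E _ _ _ p hp _ => hlow E p hp.le, fun p hp _ => hlog p hp.le⟩⟩
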